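/- Let $\mathcal T_h$ be a finite conforming tetrahedral grid in $\mathbb R^3$ (any two closed simplices of the grid meet in a common face or not at all; all tetrahedra are non-degenerate), and assume that the polyhedral domain $\Omega$ it triangulates, i.e. the interior of the union of its tetrahedra, is (nonempty and) connected. For $T\in\mathcal T_h$ with vertices $\mathbf x_1,\dots,\mathbf x_4$ let $\lambda_1,\dots,\lambda_4\in P_1(T)$ be its barycentric coordinates, $\lambda_i(\mathbf x_j)=\delta_{ij}$, let $F_i$ be the face of $T$ opposite to $\mathbf x_i$, and put $$\Phi_0 = 2-4\sum_{k=1}^4\lambda_k^2,\qquad \Phi_i = 12(1-\lambda_i)^2-18\sum_{k\ne i}\lambda_k^2-\left(\tfrac32\right)^3\Phi_0\quad(i=1,\dots,4).$$ Call a triangle (an edge, a vertex) of the grid interior if its barycentre (its midpoint, the vertex itself) lies in $\Omega$, and fix a unit normal vector $\mathbf n_F$ on every interior triangle $F$. Let $\mathbf E_1,\mathbf E_2,\mathbf E_3$ be the standard basis of $\mathbb R^3$. Let $\mathbf V_h$ be the space of piecewise $P_2$ vector fields on $\mathcal T_h$ spanned by * for each $T\in\mathcal T_h$ and $m=1,2,3$,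 the field equal to $\Phi_0\mathbf E_m$ on $T$ and $0$ on all other tetrahedra; * for each interior triangle $F$, the field equal to $\Phi_i\mathbf n_F$ on each of the two tetrahedra having $F$ as a face (with $i$ such that $F=F_i$ in that tetrahedron), and $0$ on all other tetrahedra; * the continuous $P_2$ Lagrange nodal basis functions, times $\mathbf E_m$ ($m=1,2,3$), at the interior vertices and at the midpoints of the interior edges (the space they span is that of continuous piecewise $P_2$ vector fields vanishing on $\partial\Omega$). Let $P_h=\{p_h\in L^2(\Omega):\int_\Omega p_h\,d\mathbf x=0,\ p_h|_T\in P_1(T)\ \text{for all } T\in\mathcal T_h\}$. Let $\nabla_h$ and $\mathrm{div}_h$ be the piecewise gradient and divergence on $\mathcal T_h$, and $(\cdot,\cdot)$ the $L^2(\Omega)$ inner product. Then for every $\mathbf f\in L^2(\Omega)^3$ there is exactly one pair $(\mathbf u_h,p_h)\in\mathbf V_h\times P_h$ such that $$(\nabla_h\mathbf u_h,\nabla_h\mathbf v_h)-(\mathrm{div}_h\mathbf v_h,p_h)=(\mathbf f,\mathbf v_h)\quad\forall\,\mathbf v_h\in\mathbf V_h,$$ $$(\mathrm{div}_h\mathbf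 u_h,q_h)=0\quad\forall\,q_h\in P_h.$$ -/

import Mathlib

open MeasureTheory
open scoped Classical

/-- Three-dimensional Euclidean space. -/
abbrev E3 : Type := EuclideanSpace ℝ (Fin 3)

/-- A conforming tetrahedral grid: a finite simplicial complex in `ℝ³` (any two cells meet in a
common face or not at all), every simplex of which is a face of a (non-degenerate) tetrahedron. -/
structure TetGrid extends Geometry.SimplicialComplex ℝ E3 where
  finite_faces : faces.Finite
  exists_tet : ∀ s ∈ faces, ∃ t ∈ faces, s ⊆ t ∧ t.card = 4

namespace TetGrid

/-- The tetrahedra of the grid; each of them is given by the set of its four vertices. -/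
def Tet (G : TetGrid) : Type := {t : Finset E3 // t ∈ G.faces ∧ t.card = 4}

noncomputable instance (G : TetGrid) : Fintype G.Tet :=
  (G.finite_faces.subset fun _ h => h.1 : {t | t ∈ G.faces ∧ t.card = 4}.Finite).fintype

/-- The polyhedral domain `Ω` triangulated by the grid: the interior of the union of all
tetrahedra. -/
def domain (G : TetGrid) : Set E3 := interior G.space

/-- The closed tetrahedron as a point set. -/
def Tet.carrier {G : TetGrid} (T : G.Tet) : Set E3 := convexHull ℝ (T.1 : Set E3)

theorem Tet.indep {G : TetGrid} (T : G.Tet) : AffineIndependent ℝ ((↑) : T.1 → E3) :=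
  G.toSimplicialComplex.indep T.2.1

/-- The vertices of a tetrahedron form an affine basis of `ℝ³`. -/
noncomputable def Tet.basis {G : TetGrid} (T : G.Tet) : AffineBasis T.1 ℝ E3 :=
  ⟨(↑), T.indep, by
    rw [T.indep.affineSpan_eq_top_iff_card_eq_finrank_add_one]
    simp [T.2.2]⟩

/-- The barycentric coordinate `λ_a` of the tetrahedron `T` that belongs to the vertex `a`;
by convention it is `0` if `a` is not a vertex of `T`. -/
noncomputable def Tet.bary {G : TetGrid} (T : G.Tet) (a : E3) : E3 → ℝ :=
  fun x => if h : a ∈ T.1 then T.basis.coord ⟨a, h⟩ x else 0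

theorem Tet.bary_vertex {G : TetGrid} (T : G.Tet) {a b : E3} (ha : a ∈ T.1) (hb : b ∈ T.1) :
    T.bary a b = if a = b then 1 else 0 := by
  have h : T.basis.coord ⟨a, ha⟩ b = _ := T.basis.coord_apply ⟨a, ha⟩ ⟨b, hb⟩
  simp only [Tet.bary, dif_pos ha, h, Subtype.mk.injEq]

/-- The central bubble `Φ₀ = 2 - 4 (λ₁² + λ₂² + λ₃² + λ₄²)` of `T`. -/
noncomputable def Tet.centralBubble {G : TetGrid} (T : G.Tet) : E3 → ℝ :=
  fun x => 2 - 4 * ∑ b ∈ T.1, T.bary b x ^ 2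

/-- The bubble `Φ_a = 12 (1 - λ_a)² - 18 ∑_{b ≠ a} λ_b² - (3/2)³ Φ₀` of `T`, which belongs to the
face of `T` opposite to its vertex `a`. -/
noncomputable def Tet.faceBubble {G : TetGrid} (T : G.Tet) (a : E3) : E3 → ℝ :=
  fun x => 12 * (1 - T.bary a x) ^ 2 - 18 * ∑ b ∈ T.1.erase a, T.bary b x ^ 2
    - (3 / 2 : ℝ) ^ 3 * T.centralBubble x

/-- The Cartesian unit vectors `E₁, E₂, E₃`. -/
noncomputable def unitVec (m : Fin 3) : E3 := EuclideanSpace.single m 1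

/-- Piecewise defined vector fields: one vector field for every tetrahedron. A piecewise polynomial
field `v` on the grid is given by the polynomials `v T` with `v = v T` on `T`; no continuity
between tetrahedra is imposed. -/
abbrev BrokenField (G : TetGrid) : Type := G.Tet → E3 → E3

/-- Piecewise defined scalar functions: one function for every tetrahedron. -/
abbrev BrokenScalar (G : TetGrid) : Type := G.Tet → E3 → ℝ

/-- The interior vertices of the grid. -/
def interiorVertices (G : TetGrid) : Set E3 := {a | {a} ∈ G.faces ∧ a ∈ G.domain}

/-- The interior edges (given by their end points): those with midpoint in `Ω`. -/
def interiorEdges (G : TetGrid) : Set (Finset E3) :=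
  {e | e ∈ G.faces ∧ e.card = 2 ∧ e.centroid ℝ id ∈ G.domain}

/-- The interior triangles (given by their vertices): those with barycentre in `Ω`. -/
def interiorTriangles (G : TetGrid) : Set (Finset E3) :=
  {F | F ∈ G.faces ∧ F.card = 3 ∧ F.centroid ℝ id ∈ G.domain}

/-- The first type of bubble basis functions: `Φ₀ E_m` on the tetrahedron `S`, zero on all other
tetrahedra. -/
noncomputable def cellBasis (G : TetGrid) (S : G.Tet) (m : Fin 3) : G.BrokenField :=
  fun T x => if T = S then T.centralBubble x • unitVec m else 0

/-- The second type of bubble basis functions, for a triangle `F` with unit normal vector `ν`: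
`Φ_a ν` on every tetrahedron `T` that has `F` as its face opposite to one of its vertices `a`
(there is at most one such `a`), zero on all other tetrahedra. -/
noncomputable def faceBasis (G : TetGrid) (F : Finset E3) (ν : E3) : G.BrokenField :=
  fun T x => ∑ a ∈ T.1 with T.1.erase a = F, T.faceBubble a x • ν

/-- The continuous `P₂` nodal basis functions at a vertex `a`: `λ_a (2 λ_a - 1) E_m` on the
tetrahedra with vertex `a`, zero on the others. -/
noncomputable def vertexBasis (G : TetGrid) (a : E3) (m : Fin 3) : G.BrokenField :=
  fun T x => (T.bary a x * (2 * T.bary a x - 1)) • unitVec m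

/-- The continuous `P₂` nodal basis functions at the midpoint of an edge `e = {a, b}`:
`4 λ_a λ_b E_m` on the tetrahedra with edge `e`, zero on the others. -/
noncomputable def edgeBasis (G : TetGrid) (e : Finset E3) (m : Fin 3) : G.BrokenField :=
  fun T x => (4 * ∏ a ∈ e, T.bary a x) • unitVec m

/-- `n` assigns to every interior triangle one of its two unit normal vectors. -/
def IsUnitNormalField (G : TetGrid) (n : Finset E3 → E3) : Prop :=
  ∀ F ∈ G.interiorTriangles, ‖n F‖ = 1 ∧ ∀ x ∈ F, ∀ y ∈ F, inner ℝ (n F) (x - y) = 0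

/-- The velocity space `V_h`: the span of the bubbles on all tetrahedra, of the normal bubbles on
the interior triangles, and of the `P₂` nodal basis functions at the interior vertices and at the
midpoints of the interior edges. -/
noncomputable def velocitySpace (G : TetGrid) (n : Finset E3 → E3) :
    Submodule ℝ G.BrokenField :=
  Submodule.span ℝ
    ({v | ∃ (S : G.Tet) (m : Fin 3), v = G.cellBasis S m} ∪
      {v | ∃ F ∈ G.interiorTriangles, v = G.faceBasis F (n F)} ∪
      {v | ∃ a ∈ G.interiorVertices, ∃ m : Fin 3, v = G.vertexBasis a m} ∪
      {v | ∃ e ∈ G.interiorEdges, ∃ m : Fin 3, v = G.edgeBasis e m})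

theorem integrableOn_affine {G : TetGrid} (T : G.Tet) (a : E3 →ᵃ[ℝ] ℝ) :
    IntegrableOn (fun x => a x) T.carrier :=
  (a.continuous_of_finiteDimensional.continuousOn).integrableOn_compact
    (T.1.finite_toSet.isCompact_convexHull (𝕜 := ℝ))

/-- The pressure space `P_h`: discontinuous piecewise affine functions with mean value zero
over `Ω`. -/
noncomputable def pressureSpace (G : TetGrid) : Submodule ℝ G.BrokenScalar where
  carrier := {p | (∀ T, ∃ a : E3 →ᵃ[ℝ] ℝ, p T = a) ∧ ∑ T, ∫ x in T.carrier, p T x = 0}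
  zero_mem' := ⟨fun _ => ⟨0, rfl⟩, by simp⟩
  add_mem' := by
    rintro p q ⟨hp, hp0⟩ ⟨hq, hq0⟩
    refine ⟨fun T => ?_, ?_⟩
    · obtain ⟨a, ha⟩ := hp T
      obtain ⟨b, hb⟩ := hq T
      exact ⟨a + b, by simp [ha, hb]⟩
    · rw [← add_zero (0 : ℝ)]
      nth_rewrite 1 [← hp0]
      rw [← hq0, ← Finset.sum_add_distrib]
      refine Finset.sum_congr rfl fun T _ => ?_
      obtain ⟨a, ha⟩ := hp T
      obtain ⟨b, hb⟩ := hq T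
      simp only [Pi.add_apply, ha, hb]
      exact integral_add (integrableOn_affine T a) (integrableOn_affine T b)
  smul_mem' := by
    rintro c p ⟨hp, hp0⟩
    refine ⟨fun T => ?_, ?_⟩
    · obtain ⟨a, ha⟩ := hp T
      exact ⟨c • a, by simp [ha]⟩
    · simp only [Pi.smul_apply, smul_eq_mul, integral_const_mul, ← Finset.mul_sum, hp0, mul_zero]

/-- The divergence `∂₁ w₁ + ∂₂ w₂ + ∂₃ w₃` of a vector field. -/
noncomputable def divergence (w : E3 → E3) (x : E3) : ℝ :=
  ∑ i : Fin 3, (fderiv ℝ w x (unitVec i)) i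

/-- `(∇_h u, ∇_h v)`, the `L²` inner product of the piecewise gradients. -/
noncomputable def gradForm (G : TetGrid) (u v : G.BrokenField) : ℝ :=
  ∑ T, ∫ x in T.carrier, ∑ i : Fin 3, ∑ j : Fin 3,
    (fderiv ℝ (u T) x (unitVec i)) j * (fderiv ℝ (v T) x (unitVec i)) j

/-- `(div_h v, q)`, the `L²` inner product of the piecewise divergence of `v` with `q`. -/
noncomputable def divForm (G : TetGrid) (v : G.BrokenField) (q : G.BrokenScalar) : ℝ :=
  ∑ T, ∫ x in T.carrier, divergence (v T) x * q T x

/-- `(f, v)`, the `L²` inner product of a vector field `f` on `Ω` with `v`. -/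
noncomputable def loadForm (G : TetGrid) (f : E3 → E3) (v : G.BrokenField) : ℝ :=
  ∑ T, ∫ x in T.carrier, inner ℝ (f x) (v T x)

/-- The discrete Stokes equations for the pair `(u, p)`. -/
def IsDiscreteStokesSolution (G : TetGrid) (n : Finset E3 → E3) (f : E3 → E3)
    (u : G.BrokenField) (p : G.BrokenScalar) : Prop :=
  (∀ v ∈ G.velocitySpace n, G.gradForm u v - G.divForm v p = G.loadForm f v) ∧
    ∀ q ∈ G.pressureSpace, G.divForm u q = 0

end TetGrid

/-!
The discrete problem is a square linear system on the finite-dimensional space `V_h × P_h`, so it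
suffices to show that the homogeneous problem has only the trivial solution
(`stokesOperator_injective`). Testing it with its own solution gives `(∇_h u, ∇_h u) = 0`, and then
`(div_h v, p) = 0` for all `v ∈ V_h`.

*Velocity* (`eq_zero_of_gradForm_self_eq_zero`). The field `u` is constant on each tetrahedron. Every
field of `V_h` has continuous mean values over the faces shared by two tetrahedra, and vanishing
mean values over the other faces; since the mean of a quadratic polynomial over a triangle is the average
over the edge midpoints, this is a finite computation with the basis functions
(`faceMean_eq_of_mem_velocitySpace`, `faceMean_eq_zero_of_mem_velocitySpace`). Hence the constants
agree on adjacent tetrahedra and vanish next to an unshared face. The tetrahedra with a non-zero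
constant would form a region whose only contact with the rest of space is through edges, which is
impossible as lines do not separate space (`not_of_adjacent_of_shared`).

*Pressure* (`eq_zero_of_divForm_eq_zero`). The Lagrange basis functions are not needed here. By the
symmetry of the mass matrix of the barycentric coordinates, testing with `Φ₀ E_m` gives a non-zero
multiple of `∂_m p` on each tetrahedron, so `p` is piecewise constant. Testing with the bubble of a
face shared by two tetrahedra gives a non-zero multiple of the jump of `p`, because the gradients of
the two barycentric coordinates that vanish on the face, weighted with the volumes, are opposite
(`Tet.vol_mul_grad`). So `p` is constant on tetrahedra connected through faces. As `Ω` is connected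
and lines do not separate a ball, these are all tetrahedra (`forall_of_adjacent`), and the mean
value zero gives `p = 0`.
-/

namespace TetGrid

variable {G : TetGrid}

/-! ### Barycentric coordinates -/

/-- The barycentric coordinate `λ_a` of `T` as an affine map, extended by `0` to points `a` that
are not vertices of `T`. -/
noncomputable def Tet.baryMap (T : G.Tet) (a : E3) : E3 →ᵃ[ℝ] ℝ :=
  if h : a ∈ T.1 then T.basis.coord ⟨a, h⟩ else 0

/-- The gradient of the barycentric coordinate `λ_a`, as a continuous linear form. -/
noncomputable def Tet.grad (T : G.Tet) (a : E3) : E3 →L[ℝ] ℝ :=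
  LinearMap.toContinuousLinearMap (T.baryMap a).linear

theorem Tet.baryMap_apply (T : G.Tet) (a x : E3) : T.baryMap a x = T.bary a x := by
  unfold Tet.baryMap Tet.bary
  split_ifs <;> rfl

theorem Tet.grad_apply (T : G.Tet) (a v : E3) : T.grad a v = (T.baryMap a).linear v := rfl

theorem Tet.bary_add (T : G.Tet) (a x v : E3) : T.bary a (x + v) = T.bary a x + T.grad a v := by
  rw [← T.baryMap_apply, ← T.baryMap_apply, add_comm x v, ← vadd_eq_add, AffineMap.map_vadd,
    vadd_eq_add, add_comm, T.grad_apply]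

theorem Tet.bary_of_notMem (T : G.Tet) {a : E3} (h : a ∉ T.1) (x : E3) : T.bary a x = 0 := by
  simp [Tet.bary, h]

theorem Tet.bary_self (T : G.Tet) {a : E3} (h : a ∈ T.1) : T.bary a a = 1 := by
  simp [T.bary_vertex h h]

theorem Tet.bary_of_ne (T : G.Tet) {a b : E3} (hb : b ∈ T.1) (hab : a ≠ b) : T.bary a b = 0 := by
  by_cases ha : a ∈ T.1
  · simp [T.bary_vertex ha hb, hab]
  · exact T.bary_of_notMem ha b

theorem Tet.sum_bary (T : G.Tet) (x : E3) : ∑ a ∈ T.1, T.bary a x = 1 := by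
  rw [← T.basis.sum_coord_apply_eq_one x, ← Finset.sum_coe_sort]
  exact Finset.sum_congr rfl fun a _ => by simp [Tet.bary]

theorem Tet.sum_bary_smul (T : G.Tet) (x : E3) : ∑ a ∈ T.1, T.bary a x • a = x := by
  conv_rhs => rw [← T.basis.linear_combination_coord_eq_self x]
  rw [← Finset.sum_coe_sort]
  exact Finset.sum_congr rfl fun a _ => by simp [Tet.bary]; rfl

theorem Tet.sum_grad_apply (T : G.Tet) (v : E3) : ∑ a ∈ T.1, T.grad a v = 0 := by
  have h := T.sum_bary (0 + v)
  simp only [T.bary_add, Finset.sum_add_distrib, T.sum_bary] at h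
  linarith

theorem Tet.sum_grad_smul (T : G.Tet) (v : E3) : ∑ a ∈ T.1, T.grad a v • a = v := by
  have h := T.sum_bary_smul (0 + v)
  simp only [T.bary_add, add_smul, Finset.sum_add_distrib, T.sum_bary_smul] at h
  simpa using h

/-- An affine function is determined by its values at the vertices. -/
theorem Tet.affine_eq_sum (T : G.Tet) (f : E3 →ᵃ[ℝ] ℝ) (x : E3) :
    f x = ∑ a ∈ T.1, T.bary a x * f a := by
  have key : ∀ y : E3, f y = f.linear y + f 0 := fun y => by
    simpa using f.map_vadd 0 y
  conv_lhs => rw [key, ← T.sum_bary_smul x, map_sum]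
  simp only [map_smul, smul_eq_mul]
  have : f 0 = ∑ a ∈ T.1, T.bary a x * f 0 := by rw [← Finset.sum_mul, T.sum_bary, one_mul]
  rw [this, ← Finset.sum_add_distrib]
  exact Finset.sum_congr rfl fun a _ => by rw [key a]; ring

theorem Tet.linear_eq_sum (T : G.Tet) (f : E3 →ᵃ[ℝ] ℝ) (v : E3) :
    f.linear v = ∑ a ∈ T.1, T.grad a v * f a := by
  have h1 := f.map_vadd 0 v
  rw [vadd_eq_add, vadd_eq_add, T.affine_eq_sum f (v + 0), T.affine_eq_sum f 0, add_comm v 0] at h1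
  simp only [T.bary_add, add_mul, Finset.sum_add_distrib] at h1
  linarith

theorem Tet.continuous_bary (T : G.Tet) (a : E3) : Continuous (T.bary a) := by
  have : T.bary a = T.baryMap a := funext fun x => (T.baryMap_apply a x).symm
  rw [this]
  exact (T.baryMap a).continuous_of_finiteDimensional

theorem Tet.bary_lineMap (T : G.Tet) (a x y : E3) (t : ℝ) :
    T.bary a (AffineMap.lineMap x y t) = (1 - t) * T.bary a x + t * T.bary a y := by
  rw [← T.baryMap_apply, AffineMap.apply_lineMap, AffineMap.lineMap_apply_module]
  simp [T.baryMap_apply]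

theorem Tet.bary_midpoint (T : G.Tet) (a x y : E3) :
    T.bary a (midpoint ℝ x y) = (T.bary a x + T.bary a y) / 2 := by
  rw [midpoint, T.bary_lineMap]
  simp only [invOf_eq_inv]
  ring

theorem Tet.hasFDerivAt_bary (T : G.Tet) (a x : E3) : HasFDerivAt (T.bary a) (T.grad a) x := by
  have : T.bary a = fun y => T.bary a 0 + T.grad a y := funext fun y => by
    rw [← T.bary_add, zero_add]
  rw [this]
  exact (T.grad a).hasFDerivAt.const_add _

theorem Tet.range_basis (T : G.Tet) : Set.range T.basis = (T.1 : Set E3) :=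
  Subtype.range_coe

theorem Tet.mem_carrier_iff (T : G.Tet) {x : E3} :
    x ∈ T.carrier ↔ ∀ a ∈ T.1, 0 ≤ T.bary a x := by
  have : (T.1 : Set E3) = Set.range T.basis := T.range_basis.symm
  rw [Tet.carrier, this, AffineBasis.convexHull_eq_nonneg_coord]
  simp only [Set.mem_ofPred_eq, Subtype.forall]
  exact forall₂_congr fun a ha => by simp [Tet.bary, ha]

theorem Tet.mem_interior_iff (T : G.Tet) {x : E3} :
    x ∈ interior T.carrier ↔ ∀ a ∈ T.1, 0 < T.bary a x := by
  have : (T.1 : Set E3) = Set.range T.basis := T.range_basis.symm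
  rw [Tet.carrier, this, AffineBasis.interior_convexHull]
  simp only [Set.mem_ofPred_eq, Subtype.forall]
  exact forall₂_congr fun a ha => by simp [Tet.bary, ha]

theorem Tet.isCompact_carrier (T : G.Tet) : IsCompact T.carrier :=
  T.1.finite_toSet.isCompact_convexHull (𝕜 := ℝ)

theorem Tet.convex_carrier (T : G.Tet) : Convex ℝ T.carrier := convex_convexHull ℝ _

theorem Tet.vertex_mem (T : G.Tet) {a : E3} (h : a ∈ T.1) : a ∈ T.carrier :=
  subset_convexHull ℝ _ h

theorem Tet.interior_nonempty (T : G.Tet) : (interior T.carrier).Nonempty := by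
  have : (T.1 : Set E3) = Set.range T.basis := T.range_basis.symm
  rw [Tet.carrier, this]
  exact ⟨_, T.basis.centroid_mem_interior_convexHull⟩

theorem Tet.closure_interior (T : G.Tet) : closure (interior T.carrier) = T.carrier := by
  rw [T.convex_carrier.closure_interior_eq_closure_of_nonempty_interior T.interior_nonempty,
    T.isCompact_carrier.isClosed.closure_eq]

/-- The convex hull of a set of vertices of `T` lies in the zero set of the barycentric
coordinates of the other vertices. -/
theorem Tet.bary_eq_zero_of_mem_convexHull (T : G.Tet) {a x : E3} {s : Set E3}
    (hs : ∀ b ∈ s, b ∈ T.1) (ha : a ∉ s) (hx : x ∈ convexHull ℝ s) : T.bary a x = 0 := by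
  have hsub : s ⊆ T.baryMap a ⁻¹' {0} := fun b hb => by
    simp only [Set.mem_preimage, Set.mem_singleton_iff, T.baryMap_apply]
    exact T.bary_of_ne (hs b hb) (by rintro rfl; exact ha hb)
  have := convexHull_min hsub ((convex_singleton (0 : ℝ)).affine_preimage (T.baryMap a)) hx
  simpa [T.baryMap_apply] using this

/-- Conformity: a point common to two tetrahedra has vanishing barycentric coordinates at all
vertices that are not common. -/
theorem Tet.mem_of_bary_ne_zero {T S : G.Tet} {x a : E3} (hT : x ∈ T.carrier) (hS : x ∈ S.carrier)
    (h : T.bary a x ≠ 0) : a ∈ S.1 := by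
  by_contra ha
  exact h (T.bary_eq_zero_of_mem_convexHull (s := (T.1 ∩ S.1 : Set E3)) (fun b hb => hb.1)
    (fun hb => ha hb.2) (G.toSimplicialComplex.inter_subset_convexHull T.2.1 S.2.1 ⟨hT, hS⟩))

theorem Tet.eq_of_subset {T S : G.Tet} (h : T.1 ⊆ S.1) : T = S :=
  Subtype.ext (Finset.eq_of_subset_of_card_le h (by rw [T.2.2, S.2.2]))

theorem space_eq (G : TetGrid) : G.space = ⋃ T : G.Tet, T.carrier := by
  ext x
  simp only [Set.mem_iUnion, Geometry.SimplicialComplex.mem_space_iff]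
  constructor
  · rintro ⟨s, hs, hx⟩
    obtain ⟨t, ht, hst, hc⟩ := G.exists_tet s hs
    exact ⟨⟨t, ht, hc⟩, convexHull_mono (Finset.coe_subset.2 hst) hx⟩
  · rintro ⟨T, hx⟩
    exact ⟨T.1, T.2.1, hx⟩

theorem Tet.carrier_subset_space (T : G.Tet) : T.carrier ⊆ G.space := by
  rw [G.space_eq]
  exact Set.subset_iUnion (fun T : G.Tet => T.carrier) T

theorem isCompact_space (G : TetGrid) : IsCompact G.space := by
  rw [G.space_eq]
  exact isCompact_iUnion fun T => T.isCompact_carrier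

/-! ### Faces shared by tetrahedra -/

theorem Tet.card_erase (T : G.Tet) {a : E3} (ha : a ∈ T.1) : (T.1.erase a).card = 3 := by
  rw [Finset.card_erase_of_mem ha, T.2.2]

/-- A triangle whose vertices belong to `T` is the face opposite to some vertex of `T`. -/
theorem Tet.exists_erase_eq (T : G.Tet) {F : Finset E3} (hF : F ⊆ T.1) (hc : F.card = 3) :
    ∃ a ∈ T.1, T.1.erase a = F := by
  have h1 : (T.1 \ F).card = 1 := by rw [Finset.card_sdiff_of_subset hF, T.2.2, hc]
  obtain ⟨a, ha⟩ := Finset.card_eq_one.1 h1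
  have ha' : a ∈ T.1 \ F := by simp [ha]
  rw [Finset.mem_sdiff] at ha'
  refine ⟨a, ha'.1, (Finset.eq_of_subset_of_card_le (fun b hb => ?_) ?_).symm⟩
  · exact Finset.mem_erase.2 ⟨by rintro rfl; exact ha'.2 hb, hF hb⟩
  · rw [T.card_erase ha'.1, hc]

theorem Tet.sum_eq_add_erase {M : Type*} [AddCommMonoid M] (T : G.Tet) {a : E3} (ha : a ∈ T.1)
    (f : E3 → M) : ∑ b ∈ T.1, f b = f a + ∑ b ∈ T.1.erase a, f b :=
  (Finset.add_sum_erase _ _ ha).symm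

/-- If `T` and `S` share the face opposite to `a` in `T` and to `c` in `S`, the two
corresponding barycentric coordinates are proportional: both vanish on the plane of that face. -/
theorem Tet.bary_eq_mul {T S : G.Tet} {a c : E3} (hc : c ∈ S.1)
    (hF : T.1.erase a = S.1.erase c) (x : E3) : T.bary a x = T.bary a c * S.bary c x := by
  rw [← T.baryMap_apply, S.affine_eq_sum, S.sum_eq_add_erase hc, Finset.sum_eq_zero, add_zero,
    T.baryMap_apply, mul_comm]
  intro b hb
  rw [← hF, Finset.mem_erase] at hb
  rw [T.baryMap_apply, T.bary_of_ne hb.2 hb.1.symm, mul_zero]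

/-- On the plane of a common face the barycentric coordinates of the face vertices agree. -/
theorem Tet.bary_eq_of_bary_eq_zero {T S : G.Tet} {a b x : E3} (ha : a ∈ T.1)
    (hF : T.1.erase a ⊆ S.1) (hx : T.bary a x = 0) (hb : b ∈ T.1.erase a) :
    S.bary b x = T.bary b x := by
  rw [← S.baryMap_apply, T.affine_eq_sum, T.sum_eq_add_erase ha, hx, zero_mul, zero_add,
    Finset.sum_eq_single b]
  · rw [S.baryMap_apply, S.bary_self (hF hb), mul_one]
  · intro d hd hdb
    rw [S.baryMap_apply, S.bary_of_ne (hF hd) hdb.symm, mul_zero]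
  · exact fun h => absurd hb h

theorem Tet.bary_centroid (T : G.Tet) {F : Finset E3} (hF : F ⊆ T.1) (h : F.Nonempty) (b : E3) :
    T.bary b (F.centroid ℝ id) = if b ∈ F then (F.card : ℝ)⁻¹ else 0 := by
  have hw : ∑ i ∈ F, F.centroidWeights ℝ i = 1 :=
    F.sum_centroidWeights_eq_one_of_nonempty ℝ h
  rw [← T.baryMap_apply, Finset.centroid_def, Finset.map_affineCombination _ _ _ hw,
    Finset.affineCombination_eq_linear_combination _ _ _ hw]
  simp only [Function.comp, id, Finset.centroidWeights_apply, smul_eq_mul, T.baryMap_apply]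
  split_ifs with hb
  · rw [Finset.sum_eq_single b, T.bary_self (hF hb), mul_one]
    · intro d hd hdb
      rw [T.bary_of_ne (hF hd) hdb.symm, mul_zero]
    · exact fun h => absurd hb h
  · refine Finset.sum_eq_zero fun d hd => ?_
    rw [T.bary_of_ne (hF hd) (by rintro rfl; exact hb hd), mul_zero]

/-- Two tetrahedra with a common face lie on opposite sides of it: otherwise points of `T` close
to the barycentre of the face would belong to both of them. -/
theorem Tet.bary_neg {T S : G.Tet} (hTS : T ≠ S) {a c : E3} (ha : a ∈ T.1) (hc : c ∈ S.1)
    (hF : T.1.erase a = S.1.erase c) : T.bary a c < 0 := by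
  have haS : a ∉ S.1 := fun h => hTS (Tet.eq_of_subset fun b hb => by
    by_cases hba : b = a
    · rwa [hba]
    · exact Finset.mem_of_mem_erase (hF ▸ Finset.mem_erase.2 ⟨hba, hb⟩))
  by_contra hneg
  push Not at hneg
  have hpos : 0 < T.bary a c := by
    refine lt_of_le_of_ne hneg fun h => ?_
    have := Tet.bary_eq_mul hc hF a
    rw [← h, T.bary_self ha] at this
    simp at this
  have hne : (T.1.erase a).Nonempty := Finset.card_pos.1 (by rw [T.card_erase ha]; norm_num)
  set m := (T.1.erase a).centroid ℝ id with hm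
  have hmT : ∀ b ∈ T.1.erase a, 0 < T.bary b m := fun b hb => by
    rw [hm, T.bary_centroid (Finset.erase_subset _ _) hne, if_pos hb, T.card_erase ha]
    norm_num
  have hmS : ∀ b ∈ T.1.erase a, 0 < S.bary b m := fun b hb => by
    rw [hm, S.bary_centroid (hF ▸ Finset.erase_subset _ _) hne, if_pos hb, T.card_erase ha]
    norm_num
  have hma : T.bary a m = 0 := by
    rw [hm, T.bary_centroid (Finset.erase_subset _ _) hne, if_neg (Finset.notMem_erase _ _)]
  have hcont : Continuous fun t : ℝ => AffineMap.lineMap m a t := AffineMap.lineMap_continuous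
  have hev : ∀ R : G.Tet, (∀ b ∈ T.1.erase a, 0 < R.bary b m) →
      ∀ᶠ t in nhdsWithin (0 : ℝ) (Set.Ioi 0),
        ∀ b ∈ T.1.erase a, 0 < R.bary b (AffineMap.lineMap m a t) := fun R hR => by
    refine Filter.Eventually.filter_mono nhdsWithin_le_nhds ?_
    rw [Filter.eventually_all_finset]
    intro b hb
    have := ((R.continuous_bary b).comp hcont).tendsto 0
    simp only [Function.comp, AffineMap.lineMap_apply_zero] at this
    exact this.eventually_const_lt (hR b hb)
  obtain ⟨t, ⟨hT, hS⟩, ht⟩ :=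
    (((hev T hmT).and (hev S hmS)).and self_mem_nhdsWithin).exists
  have ht : 0 < t := ht
  set x : E3 := AffineMap.lineMap m a t with hx
  have hxa : T.bary a x = t := by
    rw [hx, T.bary_lineMap, hma, T.bary_self ha]; ring
  have hxT : x ∈ T.carrier := T.mem_carrier_iff.2 fun b hb => by
    by_cases hba : b = a
    · rw [hba, hxa]; exact ht.le
    · exact (hT b (Finset.mem_erase.2 ⟨hba, hb⟩)).le
  have hxS : x ∈ S.carrier := S.mem_carrier_iff.2 fun b hb => by
    by_cases hbc : b = c
    · have := Tet.bary_eq_mul hc hF x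
      rw [hxa] at this
      rw [hbc]
      by_contra h
      push Not at h
      nlinarith
    · exact (hS b (hF ▸ Finset.mem_erase.2 ⟨hbc, hb⟩)).le
  exact haS (Tet.mem_of_bary_ne_zero hxT hxS (by rw [hxa]; exact ht.ne'))

/-- A relative interior point of a face shared by two tetrahedra belongs to the domain. -/
theorem Tet.mem_domain_of_shared_face {T S : G.Tet} (hTS : T ≠ S) {a c x : E3} (ha : a ∈ T.1)
    (hc : c ∈ S.1) (hF : T.1.erase a = S.1.erase c) (hxa : T.bary a x = 0)
    (hx : ∀ b ∈ T.1.erase a, 0 < T.bary b x) : x ∈ G.domain := by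
  have hneg := Tet.bary_neg hTS ha hc hF
  have hxS : ∀ b ∈ T.1.erase a, 0 < S.bary b x := fun b hb => by
    rw [Tet.bary_eq_of_bary_eq_zero ha (hF ▸ Finset.erase_subset _ _) hxa hb]
    exact hx b hb
  have hev : ∀ R : G.Tet, (∀ b ∈ T.1.erase a, 0 < R.bary b x) →
      ∀ᶠ y in nhds x, ∀ b ∈ T.1.erase a, 0 < R.bary b y := fun R hR => by
    rw [Filter.eventually_all_finset]
    exact fun b hb => ((R.continuous_bary b).tendsto x).eventually_const_lt (hR b hb)
  rw [TetGrid.domain, mem_interior_iff_mem_nhds]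
  filter_upwards [hev T hx, hev S hxS] with y hyT hyS
  rcases le_or_gt 0 (T.bary a y) with h | h
  · refine T.carrier_subset_space (T.mem_carrier_iff.2 fun b hb => ?_)
    by_cases hba : b = a
    · rwa [hba]
    · exact (hyT b (Finset.mem_erase.2 ⟨hba, hb⟩)).le
  · refine S.carrier_subset_space (S.mem_carrier_iff.2 fun b hb => ?_)
    by_cases hbc : b = c
    · have := Tet.bary_eq_mul hc hF y
      rw [hbc]
      by_contra h'
      push Not at h'
      nlinarith
    · exact (hyS b (hF ▸ Finset.mem_erase.2 ⟨hbc, hb⟩)).le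

/-- A face of `T` with a relative interior point in the domain is shared with another
tetrahedron: points just beyond the face must be covered. -/
theorem Tet.exists_neighbour {T : G.Tet} {a x : E3} (ha : a ∈ T.1) (hxΩ : x ∈ G.domain)
    (hxa : T.bary a x = 0) (hx : ∀ b ∈ T.1.erase a, 0 < T.bary b x) :
    ∃ S : G.Tet, S ≠ T ∧ T.1.erase a ⊆ S.1 := by
  have hxT : x ∈ T.carrier := T.mem_carrier_iff.2 fun b hb => by
    by_cases hba : b = a
    · rw [hba, hxa]
    · exact (hx b (Finset.mem_erase.2 ⟨hba, hb⟩)).le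
  by_cases h : ∃ S : G.Tet, S ≠ T ∧ x ∈ S.carrier
  · obtain ⟨S, hST, hxS⟩ := h
    exact ⟨S, hST, fun b hb => Tet.mem_of_bary_ne_zero hxT hxS (hx b hb).ne'⟩
  · push Not at h
    exfalso
    have hev : ∀ᶠ y in nhds x, ∀ S : G.Tet, S ≠ T → y ∉ S.carrier := by
      rw [Filter.eventually_all]
      intro S
      by_cases hST : S = T
      · exact Filter.Eventually.of_forall fun y h => absurd hST h
      · filter_upwards [S.isCompact_carrier.isClosed.isOpen_compl.mem_nhds (h S hST)] with y hy _
        exact hy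
    have hΩ : ∀ᶠ y in nhds x, y ∈ G.space := mem_interior_iff_mem_nhds.1 hxΩ
    have hcont : Filter.Tendsto (fun t : ℝ => AffineMap.lineMap x a t)
        (nhdsWithin (0 : ℝ) (Set.Iio 0)) (nhds x) := by
      have := (AffineMap.lineMap_continuous (R := ℝ) (p := x) (q := a)).tendsto 0
      rw [AffineMap.lineMap_apply_zero] at this
      exact this.mono_left nhdsWithin_le_nhds
    obtain ⟨t, ⟨h1, h2⟩, ht⟩ :=
      ((hcont.eventually (hev.and hΩ)).and self_mem_nhdsWithin).exists
    have ht : t < 0 := ht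
    rw [G.space_eq, Set.mem_iUnion] at h2
    obtain ⟨S, hS⟩ := h2
    by_cases hST : S = T
    · rw [hST] at hS
      have := T.mem_carrier_iff.1 hS a ha
      rw [T.bary_lineMap, hxa, T.bary_self ha] at this
      linarith
    · exact h1 S hST hS

/-! ### Connectedness through faces -/

theorem volume_affineSpan_eq_zero {s : Finset E3} (hs : s.card ≤ 3) :
    volume (affineSpan ℝ (s : Set E3) : Set E3) = 0 := by
  refine Measure.addHaar_affineSubspace _ _ fun htop => ?_
  have h1 : Module.finrank ℝ (vectorSpan ℝ (s : Set E3)) = 3 := by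
    rw [← direction_affineSpan, htop, AffineSubspace.direction_top, finrank_top]
    exact finrank_euclideanSpace_fin
  rcases s.eq_empty_or_nonempty with rfl | hne
  · rw [Finset.coe_empty, vectorSpan_empty, finrank_bot] at h1
    omega
  · have h2 := finrank_vectorSpan_image_finset_le ℝ (id : E3 → E3) s (n := s.card - 1)
      (by have := hne.card_pos; omega)
    rw [Finset.image_id] at h2
    omega

/-- A finite union of affine spans of at most three points has empty interior. -/
theorem exists_mem_notMem_affineSpan {U : Set E3} (hU : IsOpen U) (hne : U.Nonempty)
    (E : Finset (Finset E3)) (hE : ∀ e ∈ E, e.card ≤ 3) :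
    ∃ x ∈ U, ∀ e ∈ E, x ∉ affineSpan ℝ (e : Set E3) := by
  by_contra! h
  have hsub : U ⊆ ⋃ e ∈ E, (affineSpan ℝ (e : Set E3) : Set E3) := fun x hx => by
    obtain ⟨e, he, hxe⟩ := h x hx
    exact Set.mem_biUnion he hxe
  have h0 : volume U = 0 := measure_mono_null hsub <|
    (measure_biUnion_null_iff E.countable_toSet).2 fun e he => volume_affineSpan_eq_zero (hE e he)
  exact (hU.measure_pos volume hne).ne' h0

/-- Finitely many lines do not separate a convex open set: two closed sets that cover it, and
whose interiors both meet it, have a common point off the lines. The segment between generic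
points of the two interiors misses all lines. -/
theorem exists_mem_inter_notMem_lines {K K' B : Set E3} (hK : IsClosed K) (hK' : IsClosed K')
    (hB : Convex ℝ B) (hBo : IsOpen B) (hcov : B ⊆ K ∪ K') (h : (B ∩ interior K).Nonempty)
    (h' : (B ∩ interior K').Nonempty) (E : Finset (Finset E3)) (hE : ∀ e ∈ E, e.card ≤ 2) :
    ∃ x ∈ K, x ∈ K' ∧ ∀ e ∈ E, x ∉ affineSpan ℝ (e : Set E3) := by
  obtain ⟨z, hz, hzE⟩ := exists_mem_notMem_affineSpan (hBo.inter isOpen_interior) h E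
    fun e he => (hE e he).trans (by norm_num)
  obtain ⟨w, hw, hwE⟩ := exists_mem_notMem_affineSpan (hBo.inter isOpen_interior) h'
    (E.image (insert z)) fun e he => by
      obtain ⟨e', he', rfl⟩ := Finset.mem_image.1 he
      exact (Finset.card_insert_le _ _).trans (by have := hE e' he'; omega)
  have hseg := hB.segment_subset hz.1 hw.1
  obtain ⟨q, hq, hqK, hqK'⟩ := isPreconnected_closed_iff.1 (convex_segment z w).isPreconnected
    K K' hK hK' (hseg.trans hcov) ⟨z, left_mem_segment ℝ z w, interior_subset hz.2⟩
    ⟨w, right_mem_segment ℝ z w, interior_subset hw.2⟩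
  refine ⟨q, hqK, hqK', fun e he hqe => ?_⟩
  rw [segment_eq_image_lineMap] at hq
  obtain ⟨t, -, rfl⟩ := hq
  by_cases ht : t = 0
  · rw [ht, AffineMap.lineMap_apply_zero] at hqe
    exact hzE e he hqe
  · refine hwE _ (Finset.mem_image_of_mem _ he) ?_
    have hz' : z ∈ affineSpan ℝ ((insert z e : Finset E3) : Set E3) :=
      subset_affineSpan ℝ _ (by simp)
    have hq' : AffineMap.lineMap z w t ∈ affineSpan ℝ ((insert z e : Finset E3) : Set E3) :=
      affineSpan_mono ℝ (by simp) hqe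
    have hline := AffineMap.lineMap_mem t⁻¹ hz' hq'
    rwa [AffineMap.lineMap_lineMap_right, inv_mul_cancel₀ ht, AffineMap.lineMap_apply_one] at hline

/-- Two different tetrahedra are adjacent if they share a triangular face. -/
def Adjacent (T S : G.Tet) : Prop :=
  T ≠ S ∧ ∃ a ∈ T.1, ∃ c ∈ S.1, T.1.erase a = S.1.erase c

/-- All sets of at most two vertices of a common tetrahedron. -/
noncomputable def skeleton (G : TetGrid) : Finset (Finset E3) :=
  Finset.univ.biUnion fun T : G.Tet => T.1.powerset.filter fun e => e.card ≤ 2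

theorem card_le_of_mem_skeleton {e : Finset E3} (he : e ∈ G.skeleton) : e.card ≤ 2 := by
  simp only [skeleton, Finset.mem_biUnion, Finset.mem_filter] at he
  obtain ⟨T, -, -, h⟩ := he
  exact h

/-- A point of `T` off the lines that carry the edges has at least three non-zero barycentric
coordinates. -/
theorem Tet.three_le_card_support {T : G.Tet} {x : E3} (hx : x ∈ T.carrier)
    (hE : ∀ e ∈ G.skeleton, x ∉ affineSpan ℝ (e : Set E3)) :
    3 ≤ (T.1.filter fun b => T.bary b x ≠ 0).card := by
  by_contra! h
  refine hE (T.1.filter fun b => T.bary b x ≠ 0) ?_ ?_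
  · simp only [skeleton, Finset.mem_biUnion, Finset.mem_filter, Finset.mem_powerset]
    exact ⟨T, Finset.mem_univ _, Finset.filter_subset _ _, by omega⟩
  · refine convexHull_subset_affineSpan _
      (Finset.mem_convexHull'.2 ⟨fun b => T.bary b x, ?_, ?_, ?_⟩)
    · exact fun b hb => T.mem_carrier_iff.1 hx b (Finset.mem_of_mem_filter b hb)
    · rw [Finset.sum_filter_ne_zero, T.sum_bary]
    · conv_rhs => rw [← T.sum_bary_smul x]
      refine Finset.sum_subset (Finset.filter_subset _ _) fun b hb hb' => ?_
      have : T.bary b x = 0 := by simpa [hb] using hb'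
      simp only [this, zero_smul]

theorem Tet.adjacent_of_mem {T S : G.Tet} (hTS : T ≠ S) {x : E3} (hT : x ∈ T.carrier)
    (hS : x ∈ S.carrier) (hE : ∀ e ∈ G.skeleton, x ∉ affineSpan ℝ (e : Set E3)) :
    Adjacent T S := by
  have h3 : 3 ≤ (T.1 ∩ S.1).card := (Tet.three_le_card_support hT hE).trans <|
    Finset.card_le_card fun b hb => by
      rw [Finset.mem_filter] at hb
      exact Finset.mem_inter.2 ⟨hb.1, Tet.mem_of_bary_ne_zero hT hS hb.2⟩
  have hc : (T.1 ∩ S.1).card = 3 := by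
    refine le_antisymm ?_ h3
    by_contra! h4
    refine hTS (Tet.eq_of_subset ?_)
    have := Finset.eq_of_subset_of_card_le (Finset.inter_subset_left : T.1 ∩ S.1 ⊆ T.1)
      (by rw [T.2.2]; omega)
    exact Finset.inter_eq_left.1 this
  obtain ⟨a, ha, hFa⟩ := T.exists_erase_eq Finset.inter_subset_left hc
  obtain ⟨c, hc, hFc⟩ := S.exists_erase_eq Finset.inter_subset_right hc
  exact ⟨hTS, a, ha, c, hc, hFa.trans hFc.symm⟩

theorem isClosed_iUnion_carrier (p : G.Tet → Prop) :
    IsClosed (⋃ T ∈ {T | p T}, Tet.carrier T) :=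
  (Set.toFinite _).isClosed_biUnion fun T _ => T.isCompact_carrier.isClosed

/-- A connected domain is connected through faces: a property of tetrahedra that passes to
adjacent tetrahedra holds for all of them or for none. -/
theorem forall_of_adjacent (hconn : IsConnected G.domain) {p : G.Tet → Prop}
    (hp : ∀ T S, Adjacent T S → p T → p S) {T : G.Tet} (hT : p T) (S : G.Tet) : p S := by
  by_contra hS
  set K : Set E3 := ⋃ T ∈ {T | p T}, Tet.carrier T
  set K' : Set E3 := ⋃ T ∈ {T | ¬ p T}, Tet.carrier T
  have hcov : G.space ⊆ K ∪ K' := fun x hx => by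
    rw [G.space_eq, Set.mem_iUnion] at hx
    obtain ⟨R, hR⟩ := hx
    by_cases h : p R
    · exact Or.inl (Set.mem_biUnion h hR)
    · exact Or.inr (Set.mem_biUnion h hR)
  have hint : ∀ R : G.Tet, interior R.carrier ⊆ G.domain := fun R =>
    interior_mono R.carrier_subset_space
  obtain ⟨x, hxΩ, hxK, hxK'⟩ := isPreconnected_closed_iff.1 hconn.isPreconnected K K'
    (isClosed_iUnion_carrier _) (isClosed_iUnion_carrier _) (interior_subset.trans hcov)
    (T.interior_nonempty.mono fun y hy => ⟨hint T hy, Set.mem_biUnion hT (interior_subset hy)⟩)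
    (S.interior_nonempty.mono fun y hy => ⟨hint S hy, Set.mem_biUnion hS (interior_subset hy)⟩)
  obtain ⟨r, hr, hball⟩ := Metric.isOpen_iff.1 (isOpen_interior : IsOpen G.domain) x hxΩ
  have hmeet : ∀ (q : G.Tet → Prop), x ∈ ⋃ T ∈ {T | q T}, Tet.carrier T →
      (Metric.ball x r ∩ interior (⋃ T ∈ {T | q T}, Tet.carrier T)).Nonempty := fun q hx => by
    obtain ⟨R, hR, hxR⟩ := Set.mem_iUnion₂.1 hx
    rw [← R.closure_interior] at hxR
    exact (mem_closure_iff.1 hxR _ Metric.isOpen_ball (Metric.mem_ball_self hr)).mono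
      (Set.inter_subset_inter_right _ (interior_mono fun y hy => Set.mem_biUnion hR hy))
  obtain ⟨y, hyK, hyK', hyE⟩ := exists_mem_inter_notMem_lines (isClosed_iUnion_carrier p)
    (isClosed_iUnion_carrier fun T => ¬ p T) (convex_ball x r) Metric.isOpen_ball
    (hball.trans (interior_subset.trans hcov)) (hmeet _ hxK) (hmeet _ hxK') G.skeleton
    fun e he => card_le_of_mem_skeleton he
  obtain ⟨R, hR, hyR⟩ := Set.mem_iUnion₂.1 hyK
  obtain ⟨R', hR', hyR'⟩ := Set.mem_iUnion₂.1 hyK'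
  exact hR' (hp R R' (Tet.adjacent_of_mem (by rintro rfl; exact hR' hR) hyR hyR' hyE) hR)

/-- A set of tetrahedra that is closed under adjacency and all of whose faces are shared is empty:
otherwise the complement of the grid could only be reached from it through edges. -/
theorem not_of_adjacent_of_shared {p : G.Tet → Prop} (hp : ∀ T S, Adjacent T S → p T → p S)
    (hshared : ∀ T, p T → ∀ a ∈ T.1, ∃ S : G.Tet, S ≠ T ∧ T.1.erase a ⊆ S.1) (T : G.Tet) :
    ¬ p T := by
  intro hT
  set K : Set E3 := ⋃ T ∈ {T | p T}, Tet.carrier T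
  set K' : Set E3 := (⋃ T ∈ {T | ¬ p T}, Tet.carrier T) ∪ closure (G.space)ᶜ
  have hcov : Set.univ ⊆ K ∪ K' := fun x _ => by
    by_cases hx : x ∈ G.space
    · rw [G.space_eq, Set.mem_iUnion] at hx
      obtain ⟨R, hR⟩ := hx
      by_cases h : p R
      · exact Or.inl (Set.mem_biUnion h hR)
      · exact Or.inr (Or.inl (Set.mem_biUnion h hR))
    · exact Or.inr (Or.inr (subset_closure hx))
  have hout : (G.space)ᶜ.Nonempty := by
    rw [Set.nonempty_compl]
    intro h
    exact noncompact_univ E3 (h ▸ G.isCompact_space)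
  obtain ⟨y, hyK, hyK', hyE⟩ := exists_mem_inter_notMem_lines (isClosed_iUnion_carrier p)
    ((isClosed_iUnion_carrier fun T => ¬ p T).union isClosed_closure : IsClosed K') convex_univ
    isOpen_univ hcov
    (T.interior_nonempty.mono fun y hy =>
      ⟨Set.mem_univ y, interior_mono (fun z hz => Set.mem_biUnion hT hz) hy⟩)
    (hout.mono fun y hy => ⟨Set.mem_univ y, mem_interior.2 ⟨_,
      subset_closure.trans Set.subset_union_right, G.isCompact_space.isClosed.isOpen_compl, hy⟩⟩)
    G.skeleton fun e he => card_le_of_mem_skeleton he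
  obtain ⟨R, hR, hyR⟩ := Set.mem_iUnion₂.1 hyK
  rcases hyK' with hyK' | hyK'
  · obtain ⟨R', hR', hyR'⟩ := Set.mem_iUnion₂.1 hyK'
    exact hR' (hp R R' (Tet.adjacent_of_mem (by rintro rfl; exact hR' hR) hyR hyR' hyE) hR)
  · rw [closure_compl] at hyK'
    refine hyK' ?_
    have hnn := R.mem_carrier_iff.1 hyR
    have h3 := Tet.three_le_card_support hyR hyE
    by_cases hall : ∀ b ∈ R.1, R.bary b y ≠ 0
    · exact interior_mono R.carrier_subset_space
        (R.mem_interior_iff.2 fun b hb => lt_of_le_of_ne (hnn b hb) (hall b hb).symm)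
    · push Not at hall
      obtain ⟨a, ha, hay⟩ := hall
      have hsupp : (R.1.filter fun b => R.bary b y ≠ 0) = R.1.erase a :=
        Finset.eq_of_subset_of_card_le (fun b hb => by
          rw [Finset.mem_filter] at hb
          exact Finset.mem_erase.2 ⟨by rintro rfl; exact hb.2 hay, hb.1⟩)
          (by rwa [R.card_erase ha])
      obtain ⟨S, hSR, hsub⟩ := hshared R hR a ha
      obtain ⟨c, hc, hF⟩ := S.exists_erase_eq hsub (R.card_erase ha)
      refine Tet.mem_domain_of_shared_face hSR.symm ha hc hF.symm hay fun b hb => ?_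
      rw [← hsupp, Finset.mem_filter] at hb
      exact lt_of_le_of_ne (hnn b hb.1) hb.2.symm

/-! ### Maps with affine derivative -/

/-- The maps on `ℝ³` whose derivative is an affine function of the base point, i.e. the polynomial
maps of degree at most two. -/
def quadraticMaps (V : Type*) [NormedAddCommGroup V] [NormedSpace ℝ V] :
    Submodule ℝ (E3 → V) where
  carrier := {w | ∃ A : E3 →ᵃ[ℝ] (E3 →L[ℝ] V), ∀ x, HasFDerivAt w (A x) x}
  zero_mem' := ⟨0, fun x => hasFDerivAt_const (0 : V) x⟩
  add_mem' := by
    rintro v w ⟨A, hA⟩ ⟨B, hB⟩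
    exact ⟨A + B, fun x => (hA x).add (hB x)⟩
  smul_mem' := by
    rintro c w ⟨A, hA⟩
    exact ⟨c • A, fun x => (hA x).const_smul c⟩

section quadraticMaps

variable {V : Type*} [NormedAddCommGroup V] [NormedSpace ℝ V]

theorem const_mem_quadraticMaps (v : V) : (fun _ => v) ∈ quadraticMaps V :=
  ⟨0, fun x => hasFDerivAt_const v x⟩

theorem Tet.bary_mem_quadraticMaps (T : G.Tet) (a : E3) : T.bary a ∈ quadraticMaps ℝ :=
  ⟨AffineMap.const ℝ E3 (T.grad a), fun x => T.hasFDerivAt_bary a x⟩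

theorem Tet.bary_mul_mem_quadraticMaps (T : G.Tet) (a b : E3) :
    (fun x => T.bary a x * T.bary b x) ∈ quadraticMaps ℝ := by
  refine ⟨(LinearMap.toSpanSingleton ℝ (E3 →L[ℝ] ℝ) (T.grad b)).toAffineMap.comp (T.baryMap a) +
    (LinearMap.toSpanSingleton ℝ (E3 →L[ℝ] ℝ) (T.grad a)).toAffineMap.comp (T.baryMap b),
    fun x => ?_⟩
  refine ((T.hasFDerivAt_bary a x).mul (T.hasFDerivAt_bary b x)).congr_fderiv ?_
  rw [← T.baryMap_apply, ← T.baryMap_apply]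
  rfl

theorem smul_mem_quadraticMaps {φ : E3 → ℝ} (hφ : φ ∈ quadraticMaps ℝ) (v : V) :
    (fun x => φ x • v) ∈ quadraticMaps V := by
  obtain ⟨A, hA⟩ := hφ
  exact ⟨((ContinuousLinearMap.smulRightL ℝ E3 V).flip v).toLinearMap.toAffineMap.comp A,
    fun x => (hA x).smul_const v⟩

theorem continuous_of_mem_quadraticMaps {w : E3 → V} (hw : w ∈ quadraticMaps V) :
    Continuous w := by
  obtain ⟨A, hA⟩ := hw
  exact continuous_iff_continuousAt.2 fun x => (hA x).continuousAt

theorem differentiable_of_mem_quadraticMaps {w : E3 → V} (hw : w ∈ quadraticMaps V) :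
    Differentiable ℝ w := by
  obtain ⟨A, hA⟩ := hw
  exact fun x => (hA x).differentiableAt

theorem continuous_fderiv_of_mem_quadraticMaps [FiniteDimensional ℝ V] {w : E3 → V}
    (hw : w ∈ quadraticMaps V) : Continuous (fderiv ℝ w) := by
  obtain ⟨A, hA⟩ := hw
  have : fderiv ℝ w = A := funext fun x => (hA x).fderiv
  rw [this]
  exact A.continuous_of_finiteDimensional

/-- A quadratic map whose derivative vanishes on a nonempty open set is constant. -/
theorem eq_of_fderiv_eq_zero {w : E3 → V} (hw : w ∈ quadraticMaps V) {U : Set E3} (hU : IsOpen U)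
    (hne : U.Nonempty) (h : ∀ x ∈ U, fderiv ℝ w x = 0) (x y : E3) : w x = w y := by
  have hd := differentiable_of_mem_quadraticMaps hw
  obtain ⟨A, hA⟩ := hw
  have h0 : A = 0 := AffineMap.ext_on (hU.affineSpan_eq_top hne) fun x hx => by
    rw [← (hA x).fderiv, h x hx]; rfl
  exact is_const_of_fderiv_eq_zero hd (fun z => by rw [(hA z).fderiv, h0]; rfl) x y

end quadraticMaps

theorem Tet.centralBubble_mem_quadraticMaps (T : G.Tet) : T.centralBubble ∈ quadraticMaps ℝ := by
  have : T.centralBubble =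
      (fun _ => (2 : ℝ)) - (4 : ℝ) • ∑ b ∈ T.1, fun x => T.bary b x * T.bary b x := by
    ext x
    simp [Tet.centralBubble, pow_two]
  rw [this]
  exact sub_mem (const_mem_quadraticMaps _)
    (Submodule.smul_mem _ _ (sum_mem fun b _ => T.bary_mul_mem_quadraticMaps b b))

theorem Tet.faceBubble_mem_quadraticMaps (T : G.Tet) (a : E3) :
    T.faceBubble a ∈ quadraticMaps ℝ := by
  have : T.faceBubble a =
      (12 : ℝ) • ((fun _ => (1 : ℝ)) - (2 : ℝ) • T.bary a + fun x => T.bary a x * T.bary a x)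
        - (18 : ℝ) • (∑ b ∈ T.1.erase a, fun x => T.bary b x * T.bary b x)
        - ((3 / 2 : ℝ) ^ 3) • T.centralBubble := by
    ext x
    simp only [Tet.faceBubble, Pi.sub_apply, Pi.add_apply, Pi.smul_apply, Finset.sum_apply,
      smul_eq_mul, pow_two]
    ring
  rw [this]
  refine sub_mem (sub_mem (Submodule.smul_mem _ _ (add_mem (sub_mem (const_mem_quadraticMaps _)
    (Submodule.smul_mem _ _ (T.bary_mem_quadraticMaps a))) (T.bary_mul_mem_quadraticMaps a a)))
    (Submodule.smul_mem _ _ (sum_mem fun b _ => T.bary_mul_mem_quadraticMaps b b)))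
    (Submodule.smul_mem _ _ T.centralBubble_mem_quadraticMaps)

theorem quadratic_of_mem_velocitySpace {n : Finset E3 → E3} {v : G.BrokenField}
    (hv : v ∈ G.velocitySpace n) (T : G.Tet) : v T ∈ quadraticMaps E3 := by
  induction hv using Submodule.span_induction with
  | zero => exact zero_mem _
  | add v w _ _ hv hw => exact add_mem hv hw
  | smul c v _ hv => exact Submodule.smul_mem _ c hv
  | mem v hv =>
    rcases hv with ((⟨S, m, rfl⟩ | ⟨F, -, rfl⟩) | ⟨a, -, m, rfl⟩) | ⟨e, he, m, rfl⟩
    · unfold cellBasis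
      split_ifs
      · exact smul_mem_quadraticMaps T.centralBubble_mem_quadraticMaps _
      · exact zero_mem _
    · have : G.faceBasis F (n F) T =
          ∑ a ∈ T.1 with T.1.erase a = F, fun x => T.faceBubble a x • n F := by
        ext x : 1
        simp [faceBasis]
      rw [this]
      exact sum_mem fun a _ => smul_mem_quadraticMaps (T.faceBubble_mem_quadraticMaps a) _
    · refine smul_mem_quadraticMaps (φ := fun x => T.bary a x * (2 * T.bary a x - 1)) ?_ _
      have : (fun x => T.bary a x * (2 * T.bary a x - 1)) =
          (2 : ℝ) • (fun x => T.bary a x * T.bary a x) - T.bary a := by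
        ext x
        simp only [Pi.sub_apply, Pi.smul_apply, smul_eq_mul]
        ring
      rw [this]
      exact sub_mem (Submodule.smul_mem _ _ (T.bary_mul_mem_quadraticMaps a a))
        (T.bary_mem_quadraticMaps a)
    · refine smul_mem_quadraticMaps (φ := fun x => 4 * ∏ a ∈ e, T.bary a x) ?_ _
      obtain ⟨a, b, hab, rfl⟩ := Finset.card_eq_two.1 he.2.1
      have : (fun x => 4 * ∏ c ∈ {a, b}, T.bary c x) =
          (4 : ℝ) • (fun x => T.bary a x * T.bary b x) := by
        ext x
        simp [Finset.prod_pair hab]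
      rw [this]
      exact Submodule.smul_mem _ _ (T.bary_mul_mem_quadraticMaps a b)

/-! ### Face means -/

/-- Six times the mean over the triangle `F` of a polynomial field of degree at most two, given by
the edge midpoint rule (every edge is counted twice). -/
noncomputable def faceMean (F : Finset E3) : (E3 → E3) →ₗ[ℝ] E3 where
  toFun w := ∑ p ∈ F.offDiag, w (midpoint ℝ p.1 p.2)
  map_add' v w := by simp [Finset.sum_add_distrib]
  map_smul' c w := by simp [Finset.smul_sum]

theorem faceMean_apply (F : Finset E3) (w : E3 → E3) :
    faceMean F w = ∑ p ∈ F.offDiag, w (midpoint ℝ p.1 p.2) := rfl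

theorem Tet.bary_midpoint_vertices (T : G.Tet) {a b c : E3} (ha : a ∈ T.1) (hb : b ∈ T.1)
    (hc : c ∈ T.1) (hbc : b ≠ c) :
    T.bary a (midpoint ℝ b c) = if a = b ∨ a = c then 1 / 2 else 0 := by
  rw [T.bary_midpoint, T.bary_vertex ha hb, T.bary_vertex ha hc]
  by_cases h1 : a = b <;> by_cases h2 : a = c
  · exact absurd (h1.symm.trans h2) hbc
  all_goals simp [h1, h2, hbc, hbc.symm]

theorem Tet.sum_bary_sq_midpoint (T : G.Tet) {b c : E3} (hb : b ∈ T.1) (hc : c ∈ T.1)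
    (hbc : b ≠ c) : ∑ d ∈ T.1, T.bary d (midpoint ℝ b c) ^ 2 = 1 / 2 := by
  have : ∀ d ∈ T.1, T.bary d (midpoint ℝ b c) ^ 2 =
      (if d = b then 1 / 4 else 0) + (if d = c then 1 / 4 else 0) := fun d hd => by
    rw [T.bary_midpoint_vertices hd hb hc hbc]
    by_cases h1 : d = b <;> by_cases h2 : d = c
    · exact absurd (h1.symm.trans h2) hbc
    · rw [if_pos (Or.inl h1), if_pos h1, if_neg h2]; norm_num
    · rw [if_pos (Or.inr h2), if_neg h1, if_pos h2]; norm_num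
    · rw [if_neg (by tauto), if_neg h1, if_neg h2]; norm_num
  rw [Finset.sum_congr rfl this, Finset.sum_add_distrib]
  simp [hb, hc]
  norm_num

theorem Tet.centralBubble_midpoint (T : G.Tet) {b c : E3} (hb : b ∈ T.1) (hc : c ∈ T.1)
    (hbc : b ≠ c) : T.centralBubble (midpoint ℝ b c) = 0 := by
  rw [Tet.centralBubble, T.sum_bary_sq_midpoint hb hc hbc]
  norm_num

theorem Tet.faceBubble_midpoint (T : G.Tet) {a b c : E3} (ha : a ∈ T.1) (hb : b ∈ T.1)
    (hc : c ∈ T.1) (hbc : b ≠ c) :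
    T.faceBubble a (midpoint ℝ b c) = if a = b ∨ a = c then -3 / 2 else 3 := by
  have h := T.sum_bary_sq_midpoint hb hc hbc
  rw [T.sum_eq_add_erase ha] at h
  rw [Tet.faceBubble, T.centralBubble_midpoint hb hc hbc, eq_sub_of_add_eq' h,
    T.bary_midpoint_vertices ha hb hc hbc]
  split_ifs <;> norm_num

theorem sum_offDiag_triple {M : Type*} [AddCommMonoid M] {b c d : E3} (hbc : b ≠ c) (hbd : b ≠ d)
    (hcd : c ≠ d) (f : E3 × E3 → M) : ∑ p ∈ ({b, c, d} : Finset E3).offDiag, f p =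
      f (b, c) + f (b, d) + f (c, b) + f (c, d) + f (d, b) + f (d, c) := by
  have : ({b, c, d} : Finset E3).offDiag =
      {(b, c), (b, d), (c, b), (c, d), (d, b), (d, c)} := by
    ext ⟨x, y⟩
    simp only [Finset.mem_offDiag, Finset.mem_insert, Finset.mem_singleton, Prod.mk.injEq]
    constructor
    · rintro ⟨rfl | rfl | rfl, rfl | rfl | rfl, h⟩ <;> simp_all
    · rintro (⟨rfl, rfl⟩ | ⟨rfl, rfl⟩ | ⟨rfl, rfl⟩ | ⟨rfl, rfl⟩ | ⟨rfl, rfl⟩ | ⟨rfl, rfl⟩) <;>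
        simp [hbc, hbd, hcd, hbc.symm, hbd.symm, hcd.symm]
  rw [this]
  repeat rw [Finset.sum_insert (by simp [hbc, hbd, hcd, hbc.symm, hbd.symm, hcd.symm])]
  rw [Finset.sum_singleton]
  simp only [add_assoc]

/-- The mean of the bubble of the face opposite to `a` over a face that contains `a` is zero. -/
theorem Tet.faceMean_faceBubble_of_mem (T : G.Tet) {a : E3} {F : Finset E3} (hF : F ⊆ T.1)
    (hF3 : F.card = 3) (ha : a ∈ F) (v : E3) :
    faceMean F (fun x => T.faceBubble a x • v) = 0 := by
  obtain ⟨c, d, hcd, hcd'⟩ := Finset.card_eq_two.1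
    (show (F.erase a).card = 2 by rw [Finset.card_erase_of_mem ha, hF3])
  have hc : c ∈ F.erase a := by simp [hcd']
  have hd : d ∈ F.erase a := by simp [hcd']
  rw [Finset.mem_erase] at hc hd
  have hFe : F = {a, c, d} := by rw [← Finset.insert_erase ha, hcd']
  have hval : ∀ b ∈ T.1, ∀ e ∈ T.1, b ≠ e → _ := fun b hb e he hbe =>
    T.faceBubble_midpoint (hF ha) hb he hbe
  have haT := hF ha
  have hcT := hF hc.2
  have hdT := hF hd.2
  rw [faceMean_apply, hFe, sum_offDiag_triple hc.1.symm hd.1.symm hcd,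
    hval a haT c hcT hc.1.symm, hval a haT d hdT hd.1.symm, hval c hcT a haT hc.1,
    hval c hcT d hdT hcd, hval d hdT a haT hd.1, hval d hdT c hcT hcd.symm]
  simp only [or_true, if_true, hc.1.symm, hd.1.symm, or_false, if_false, ← add_smul]
  norm_num

/-- The mean of a face bubble over its own face, in the normalisation of `faceMean`. -/
theorem Tet.faceMean_faceBubble_erase (T : G.Tet) {a : E3} (ha : a ∈ T.1) (v : E3) :
    faceMean (T.1.erase a) (fun x => T.faceBubble a x • v) = (18 : ℝ) • v := by
  have hval : ∀ p ∈ (T.1.erase a).offDiag,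
      T.faceBubble a (midpoint ℝ p.1 p.2) • v = (3 : ℝ) • v := fun p hp => by
    simp only [Finset.mem_offDiag, Finset.mem_erase] at hp
    rw [T.faceBubble_midpoint ha hp.1.2 hp.2.1.2 hp.2.2, if_neg]
    rintro (h | h)
    · exact hp.1.1 h.symm
    · exact hp.2.1.1 h.symm
  rw [faceMean_apply, Finset.sum_congr rfl hval, Finset.sum_const, Finset.offDiag_card,
    T.card_erase ha, ← Nat.cast_smul_eq_nsmul ℝ, smul_smul]
  norm_num

theorem faceMean_cellBasis {T : G.Tet} {F : Finset E3} (hF : F ⊆ T.1) (S : G.Tet) (m : Fin 3) :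
    faceMean F (G.cellBasis S m T) = 0 := by
  rw [faceMean_apply]
  refine Finset.sum_eq_zero fun p hp => ?_
  rw [Finset.mem_offDiag] at hp
  simp only [cellBasis]
  split_ifs
  · rw [T.centralBubble_midpoint (hF hp.1) (hF hp.2.1) hp.2.2, zero_smul]
  · rfl

theorem faceMean_faceBasis {T : G.Tet} {F : Finset E3} (hF : F ⊆ T.1) (hF3 : F.card = 3)
    (F' : Finset E3) (v : E3) :
    faceMean F (G.faceBasis F' v T) = if F' = F then (18 : ℝ) • v else 0 := by
  have hsum : G.faceBasis F' v T =
      ∑ a ∈ T.1 with T.1.erase a = F', fun x => T.faceBubble a x • v := by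
    ext x : 1
    simp [faceBasis]
  rw [hsum, map_sum]
  obtain ⟨a, ha, rfl⟩ := T.exists_erase_eq hF hF3
  split_ifs with h
  · subst h
    rw [Finset.sum_eq_single a, T.faceMean_faceBubble_erase ha]
    · intro b hb hba
      rw [Finset.mem_filter] at hb
      exact absurd (Finset.erase_injOn T.1 hb.1 ha hb.2) hba
    · exact fun h => absurd ha fun ha => h (Finset.mem_filter.2 ⟨ha, rfl⟩)
  · refine Finset.sum_eq_zero fun b hb => ?_
    rw [Finset.mem_filter] at hb
    refine T.faceMean_faceBubble_of_mem hF hF3 (Finset.mem_erase.2 ⟨?_, hb.1⟩) v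
    rintro rfl
    exact h hb.2.symm

theorem faceMean_vertexBasis {T : G.Tet} {F : Finset E3} (hF : F ⊆ T.1) (a : E3) (m : Fin 3) :
    faceMean F (G.vertexBasis a m T) = 0 := by
  rw [faceMean_apply]
  refine Finset.sum_eq_zero fun p hp => ?_
  rw [Finset.mem_offDiag] at hp
  simp only [vertexBasis]
  by_cases ha : a ∈ T.1
  · rw [T.bary_midpoint_vertices ha (hF hp.1) (hF hp.2.1) hp.2.2]
    split_ifs <;> norm_num
  · rw [T.bary_of_notMem ha, zero_mul, zero_smul]

theorem faceMean_edgeBasis {T : G.Tet} {F : Finset E3} (hF : F ⊆ T.1) {e : Finset E3}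
    (he : e.card = 2) (m : Fin 3) :
    faceMean F (G.edgeBasis e m T) =
      ∑ p ∈ F.offDiag, (if e = {p.1, p.2} then (1 : ℝ) else 0) • unitVec m := by
  rw [faceMean_apply]
  refine Finset.sum_congr rfl fun p hp => ?_
  rw [Finset.mem_offDiag] at hp
  simp only [edgeBasis]
  congr 1
  have hval : ∀ a ∈ e, T.bary a (midpoint ℝ p.1 p.2) = if a = p.1 ∨ a = p.2 then 1 / 2 else 0 := by
    intro a _
    by_cases ha : a ∈ T.1
    · exact T.bary_midpoint_vertices ha (hF hp.1) (hF hp.2.1) hp.2.2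
    · rw [T.bary_of_notMem ha, if_neg]
      rintro (rfl | rfl)
      · exact ha (hF hp.1)
      · exact ha (hF hp.2.1)
  rw [Finset.prod_congr rfl hval]
  split_ifs with h
  · rw [h, Finset.prod_pair hp.2.2]
    norm_num
  · have : ∃ a ∈ e, ¬ (a = p.1 ∨ a = p.2) := by
      by_contra! hall
      refine h (Finset.eq_of_subset_of_card_le (fun a ha => ?_) ?_)
      · simpa using hall a ha
      · rw [he]; exact Finset.card_le_two
    obtain ⟨a, ha, hne⟩ := this
    rw [Finset.prod_eq_zero ha (if_neg hne), mul_zero]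

/-- The fields of the velocity space have continuous face means. -/
theorem faceMean_eq_of_mem_velocitySpace {n : Finset E3 → E3} {v : G.BrokenField}
    (hv : v ∈ G.velocitySpace n) {T S : G.Tet} {F : Finset E3} (hT : F ⊆ T.1) (hS : F ⊆ S.1)
    (hF3 : F.card = 3) : faceMean F (v T) = faceMean F (v S) := by
  induction hv using Submodule.span_induction with
  | zero => rfl
  | add v w _ _ hv hw => rw [Pi.add_apply, Pi.add_apply, map_add, map_add, hv, hw]
  | smul c v _ hv => rw [Pi.smul_apply, Pi.smul_apply, map_smul, map_smul, hv]
  | mem v hv =>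
    rcases hv with ((⟨R, m, rfl⟩ | ⟨F', -, rfl⟩) | ⟨a, -, m, rfl⟩) | ⟨e, he, m, rfl⟩
    · rw [faceMean_cellBasis hT, faceMean_cellBasis hS]
    · rw [faceMean_faceBasis hT hF3, faceMean_faceBasis hS hF3]
    · rw [faceMean_vertexBasis hT, faceMean_vertexBasis hS]
    · rw [faceMean_edgeBasis hT he.2.1, faceMean_edgeBasis hS he.2.1]

/-- The fields of the velocity space have vanishing means over the faces that belong to one
tetrahedron only: neither such a face nor any of its edges is interior. -/
theorem faceMean_eq_zero_of_mem_velocitySpace {n : Finset E3 → E3} {v : G.BrokenField}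
    (hv : v ∈ G.velocitySpace n) {T : G.Tet} {a : E3} (ha : a ∈ T.1)
    (hT : ∀ S : G.Tet, S ≠ T → ¬ T.1.erase a ⊆ S.1) : faceMean (T.1.erase a) (v T) = 0 := by
  have hsub : T.1.erase a ⊆ T.1 := Finset.erase_subset _ _
  have hΩ : ∀ x, T.bary a x = 0 → (∀ b ∈ T.1.erase a, 0 < T.bary b x) → x ∉ G.domain :=
    fun x h0 hpos hx => by
      obtain ⟨S, hST, hS⟩ := Tet.exists_neighbour ha hx h0 hpos
      exact hT S hST hS
  induction hv using Submodule.span_induction with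
  | zero => exact map_zero _
  | add v w _ _ hv hw => rw [Pi.add_apply, map_add, hv, hw, add_zero]
  | smul c v _ hv => rw [Pi.smul_apply, map_smul, hv, smul_zero]
  | mem v hv =>
    rcases hv with ((⟨R, m, rfl⟩ | ⟨F', hF', rfl⟩) | ⟨b, -, m, rfl⟩) | ⟨e, he, m, rfl⟩
    · exact faceMean_cellBasis hsub R m
    · rw [faceMean_faceBasis hsub (T.card_erase ha), if_neg]
      rintro rfl
      have hne : (T.1.erase a).Nonempty := Finset.card_pos.1 (by rw [T.card_erase ha]; norm_num)
      refine hΩ _ ?_ (fun b hb => ?_) hF'.2.2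
      · rw [T.bary_centroid hsub hne, if_neg (Finset.notMem_erase _ _)]
      · rw [T.bary_centroid hsub hne, if_pos hb, T.card_erase ha]
        norm_num
    · exact faceMean_vertexBasis hsub b m
    · rw [faceMean_edgeBasis hsub he.2.1]
      refine Finset.sum_eq_zero fun p hp => ?_
      rw [if_neg, zero_smul]
      intro hep
      have hsube : e ⊆ T.1.erase a := by
        rw [Finset.mem_offDiag] at hp
        rw [hep]
        exact Finset.insert_subset hp.1 (Finset.singleton_subset_iff.2 hp.2.1)
      have hne : e.Nonempty := Finset.card_pos.1 (by rw [he.2.1]; norm_num)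
      have hneF : (T.1.erase a).Nonempty := hne.mono hsube
      -- Points of the face close to the midpoint of the edge would lie in the domain.
      have hcont : Filter.Tendsto
          (fun t : ℝ => AffineMap.lineMap (e.centroid ℝ id) ((T.1.erase a).centroid ℝ id) t)
          (nhdsWithin (0 : ℝ) (Set.Ioo 0 1)) (nhds (e.centroid ℝ id)) := by
        have := (AffineMap.lineMap_continuous (R := ℝ) (p := e.centroid ℝ id)
          (q := (T.1.erase a).centroid ℝ id)).tendsto 0
        rw [AffineMap.lineMap_apply_zero] at this
        exact this.mono_left nhdsWithin_le_nhds
      have : (nhdsWithin (0 : ℝ) (Set.Ioo 0 1)).NeBot := by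
        rw [nhdsWithin_Ioo_eq_nhdsGT one_pos]; infer_instance
      obtain ⟨t, ht, ht'⟩ := ((hcont.eventually
        ((isOpen_interior : IsOpen G.domain).mem_nhds he.2.2)).and self_mem_nhdsWithin).exists
      refine hΩ _ ?_ (fun b hb => ?_) ht
      · rw [T.bary_lineMap, T.bary_centroid (hsube.trans hsub) hne, T.bary_centroid hsub hneF,
          if_neg (Finset.notMem_erase _ _), if_neg fun h => Finset.notMem_erase _ _ (hsube h)]
        ring
      · rw [T.bary_lineMap, T.bary_centroid (hsube.trans hsub) hne, T.bary_centroid hsub hneF,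
          if_pos hb, T.card_erase ha]
        have h1 : 0 < t := ht'.1
        have h2 : 0 < 1 - t := by linarith [ht'.2]
        split_ifs <;> positivity

/-- A piecewise constant field of the velocity space is zero. -/
theorem eq_zero_of_piecewise_constant {n : Finset E3 → E3} {v : G.BrokenField}
    (hv : v ∈ G.velocitySpace n) (hc : ∀ T x y, v T x = v T y) : v = 0 := by
  have hmean : ∀ (T : G.Tet) (F : Finset E3), F.card = 3 → faceMean F (v T) = (6 : ℝ) • v T 0 :=
    fun T F hF => by
      rw [faceMean_apply, Finset.sum_congr rfl fun p _ => hc T _ 0, Finset.sum_const,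
        Finset.offDiag_card, hF, ← Nat.cast_smul_eq_nsmul ℝ]
      norm_num
  have hT : ∀ T : G.Tet, ¬ v T 0 ≠ 0 := by
    refine not_of_adjacent_of_shared (fun T S hTS hT hS => hT ?_) fun T hT a ha => ?_
    · obtain ⟨-, a, ha, c, -, hF⟩ := hTS
      have := faceMean_eq_of_mem_velocitySpace hv (Finset.erase_subset a T.1)
        (hF ▸ Finset.erase_subset _ _ : T.1.erase a ⊆ S.1) (T.card_erase ha)
      rw [hmean T _ (T.card_erase ha), hmean S _ (T.card_erase ha), hS, smul_zero] at this
      simpa using this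
    · by_contra! h
      have := faceMean_eq_zero_of_mem_velocitySpace hv ha h
      rw [hmean T _ (T.card_erase ha)] at this
      exact hT (by simpa using this)
  ext T x : 2
  rw [hc T x 0]
  exact not_not.1 (hT T)

/-! ### Integrals over tetrahedra -/

theorem Tet.integrableOn (T : G.Tet) {g : E3 → ℝ} (hg : Continuous g) :
    IntegrableOn g T.carrier :=
  hg.continuousOn.integrableOn_compact T.isCompact_carrier

/-- A nonnegative continuous function with vanishing integral over `T` vanishes on `T`. -/
theorem Tet.eq_zero_of_setIntegral_eq_zero (T : G.Tet) {g : E3 → ℝ} (hg : Continuous g)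
    (h0 : ∀ x, 0 ≤ g x) (hint : ∫ x in T.carrier, g x = 0) {x : E3} (hx : x ∈ T.carrier) :
    g x = 0 := by
  have hae := (setIntegral_eq_zero_iff_of_nonneg_ae (Filter.Eventually.of_forall h0)
    (T.integrableOn hg)).1 hint
  have hae' : g =ᵐ[volume.restrict (interior T.carrier)] 0 :=
    ae_restrict_of_ae_restrict_of_subset interior_subset hae
  have heq := Measure.eqOn_open_of_ae_eq hae' isOpen_interior hg.continuousOn continuousOn_const
  have := heq.closure hg continuous_const
  rw [T.closure_interior] at this
  exact this hx

/-- The affine map `x ↦ x + ℓ(x) v`, which moves points in the direction `v` only. -/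
noncomputable def shear (l : E3 →ᵃ[ℝ] ℝ) (v : E3) : E3 →ᵃ[ℝ] E3 :=
  AffineMap.id ℝ E3 + (LinearMap.toSpanSingleton ℝ E3 v).toAffineMap.comp l

theorem shear_apply (l : E3 →ᵃ[ℝ] ℝ) (v x : E3) : shear l v x = x + l x • v := rfl

/-- Change of variables for a shear, whose linear part `id + v ⊗ ℓ` has determinant `1 + ℓ(v)`. -/
theorem setIntegral_image_shear {l : E3 →ᵃ[ℝ] ℝ} {v : E3} (hdet : 1 + l.linear v ≠ 0) {s : Set E3}
    (hs : MeasurableSet s) (g : E3 → ℝ) :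
    ∫ x in shear l v '' s, g x = |1 + l.linear v| * ∫ x in s, g (shear l v x) := by
  have hder : ∀ x ∈ s, HasFDerivWithinAt (shear l v)
      (LinearMap.toContinuousLinearMap (LinearMap.transvection l.linear v)) s x := fun x _ => by
    have h1 : ∀ y, shear l v y =
        LinearMap.toContinuousLinearMap (LinearMap.transvection l.linear v) y + l 0 • v := by
      intro y
      have := l.map_vadd 0 y
      rw [vadd_eq_add, add_zero, vadd_eq_add] at this
      rw [shear_apply, this, add_smul, ← add_assoc]
      rfl
    rw [show (shear l v : E3 → E3) = _ from funext h1]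
    exact (ContinuousLinearMap.hasFDerivAt _).hasFDerivWithinAt.add_const _
  have hinj : Set.InjOn (shear l v) s := by
    intro x _ y _ hxy
    rw [shear_apply, shear_apply] at hxy
    have hd : x - y = (l y - l x) • v := by
      rw [sub_smul, sub_eq_sub_iff_add_eq_add, hxy]; abel
    have hl : l x - l y = l.linear (x - y) := by
      rw [← vsub_eq_sub x y, l.linearMap_vsub, vsub_eq_sub]
    rw [hd, map_smul, smul_eq_mul] at hl
    have : (1 + l.linear v) * (l x - l y) = 0 := by linarith
    rcases mul_eq_zero.1 this with h | h
    · exact absurd h hdet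
    · rw [show l y - l x = 0 by linarith, zero_smul] at hd
      exact sub_eq_zero.1 hd
  rw [integral_image_eq_integral_abs_det_fderiv_smul volume hs hder hinj g]
  simp only [ContinuousLinearMap.det, LinearMap.coe_toContinuousLinearMap,
    LinearMap.transvection.det, smul_eq_mul]
  rw [integral_const_mul]

theorem Tet.image_shear {T S : G.Tet} {l : E3 →ᵃ[ℝ] ℝ} {v : E3}
    (h : T.1.image (shear l v) = S.1) : shear l v '' T.carrier = S.carrier := by
  rw [Tet.carrier, Tet.carrier, AffineMap.image_convexHull, ← h, Finset.coe_image]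

theorem Tet.grad_sub (T : G.Tet) (a x y : E3) : T.grad a (y - x) = T.bary a y - T.bary a x := by
  have := T.bary_add a x (y - x)
  rw [add_sub_cancel] at this
  linarith

/-- The affine reflection that exchanges the vertices `a` and `b` of `T`. -/
noncomputable def Tet.swap (T : G.Tet) (a b : E3) : E3 →ᵃ[ℝ] E3 :=
  shear (T.baryMap a - T.baryMap b) (b - a)

theorem Tet.bary_swap (T : G.Tet) (a b c x : E3) : T.bary c (T.swap a b x) =
    T.bary c x + (T.bary a x - T.bary b x) * (T.bary c b - T.bary c a) := by
  rw [Tet.swap, shear_apply, T.bary_add, map_smul, T.grad_sub, smul_eq_mul]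
  simp [T.baryMap_apply]

theorem Tet.setIntegral_swap (T : G.Tet) {a b : E3} (ha : a ∈ T.1) (hb : b ∈ T.1) (hab : a ≠ b)
    (g : E3 → ℝ) : ∫ x in T.carrier, g (T.swap a b x) = ∫ x in T.carrier, g x := by
  have hdet : 1 + (T.baryMap a - T.baryMap b).linear (b - a) = -1 := by
    have : (T.baryMap a - T.baryMap b).linear (b - a) = T.grad a (b - a) - T.grad b (b - a) := rfl
    rw [this, T.grad_sub, T.grad_sub, T.bary_self ha, T.bary_self hb, T.bary_of_ne hb hab,
      T.bary_of_ne ha hab.symm]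
    norm_num
  have hmapsto : T.1.image (T.swap a b) ⊆ T.1 := by
    intro y hy
    obtain ⟨c, hc, rfl⟩ := Finset.mem_image.1 hy
    rw [Tet.swap, shear_apply]
    simp only [AffineMap.coe_sub, Pi.sub_apply, T.baryMap_apply]
    by_cases hca : c = a
    · rw [hca, T.bary_self ha, T.bary_of_ne ha hab.symm]
      simpa using hb
    · by_cases hcb : c = b
      · rw [hcb, T.bary_self hb, T.bary_of_ne hb hab]
        simpa using ha
      · rw [T.bary_of_ne hc (Ne.symm hca), T.bary_of_ne hc (Ne.symm hcb)]
        simpa using hc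
  have hinv : ∀ c ∈ T.1, T.swap a b (T.swap a b c) = c := by
    intro c hc
    have h1 := T.bary_swap a b a c
    have h2 := T.bary_swap a b b c
    rw [T.bary_self ha, T.bary_of_ne hb hab] at h1
    rw [T.bary_self hb, T.bary_of_ne ha hab.symm] at h2
    have h3 : ∀ x, T.swap a b x = x + (T.bary a x - T.bary b x) • (b - a) := fun x => by
      rw [Tet.swap, shear_apply]
      simp [T.baryMap_apply]
    rw [h3 (T.swap a b c), h1, h2, h3 c, add_assoc, ← add_smul]
    ring_nf
    simp
  have himage : T.1.image (T.swap a b) = T.1 :=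
    hmapsto.antisymm fun c hc => Finset.mem_image.2
      ⟨T.swap a b c, hmapsto (Finset.mem_image_of_mem _ hc), hinv c hc⟩
  have := setIntegral_image_shear (l := T.baryMap a - T.baryMap b) (v := b - a)
    (by rw [hdet]; norm_num) T.isCompact_carrier.measurableSet g
  rw [Tet.image_shear himage, hdet] at this
  rw [this]
  simp [Tet.swap]

/-- The volume of a tetrahedron. -/
noncomputable def Tet.vol (T : G.Tet) : ℝ := ∫ _ in T.carrier, (1 : ℝ)

theorem Tet.vol_pos (T : G.Tet) : 0 < T.vol := by
  refine lt_of_le_of_ne (integral_nonneg fun _ => zero_le_one) fun h => ?_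
  obtain ⟨x, hx⟩ := T.interior_nonempty
  exact one_ne_zero (T.eq_zero_of_setIntegral_eq_zero continuous_const (fun _ => zero_le_one)
    h.symm (interior_subset hx))

theorem Tet.setIntegral_bary (T : G.Tet) {a : E3} (ha : a ∈ T.1) :
    ∫ x in T.carrier, T.bary a x = T.vol / 4 := by
  have hsymm : ∀ b ∈ T.1, ∫ x in T.carrier, T.bary b x = ∫ x in T.carrier, T.bary a x := by
    intro b hb
    by_cases hba : b = a
    · rw [hba]
    · rw [← T.setIntegral_swap hb ha hba (T.bary a)]
      congr 1
      ext x
      rw [T.bary_swap, T.bary_self ha, T.bary_of_ne hb (Ne.symm hba)]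
      ring
  have hsum : ∑ b ∈ T.1, ∫ x in T.carrier, T.bary b x = T.vol := by
    rw [← integral_finsetSum _ fun b _ => T.integrableOn (T.continuous_bary b)]
    simp only [T.sum_bary, Tet.vol]
  rw [Finset.sum_congr rfl hsymm, Finset.sum_const, T.2.2, nsmul_eq_mul] at hsum
  push_cast at hsum
  linarith

/-- By symmetry the mass matrix of the barycentric coordinates has one diagonal and one
off-diagonal value; they differ since the coordinates do. -/
theorem Tet.exists_mass (T : G.Tet) : ∃ A B : ℝ, A ≠ B ∧ ∀ a ∈ T.1, ∀ b ∈ T.1,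
    ∫ x in T.carrier, T.bary a x * T.bary b x = if a = b then A else B := by
  set m : E3 → E3 → ℝ := fun a b => ∫ x in T.carrier, T.bary a x * T.bary b x with hm
  have hcomm : ∀ a b, m a b = m b a := fun a b => by simp only [hm, mul_comm]
  have hdiag : ∀ a ∈ T.1, ∀ b ∈ T.1, m a a = m b b := by
    intro a ha b hb
    by_cases hab : a = b
    · rw [hab]
    · simp only [hm]
      rw [← T.setIntegral_swap ha hb hab fun x => T.bary b x * T.bary b x]
      congr 1
      ext x
      rw [T.bary_swap, T.bary_self hb, T.bary_of_ne ha (Ne.symm hab)]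
      ring
  have hrow : ∀ a ∈ T.1, ∀ b ∈ T.1, ∀ c ∈ T.1, b ≠ a → c ≠ a → m a b = m a c := by
    intro a ha b hb c hc hba hca
    by_cases hbc : b = c
    · rw [hbc]
    · simp only [hm]
      rw [← T.setIntegral_swap hb hc hbc fun x => T.bary a x * T.bary c x]
      congr 1
      ext x
      rw [T.bary_swap, T.bary_swap, T.bary_self hc, T.bary_of_ne hb (Ne.symm hbc),
        T.bary_of_ne hb hba.symm, T.bary_of_ne hc hca.symm]
      ring
  obtain ⟨a₀, ha₀, b₀, hb₀, hab₀⟩ := Finset.one_lt_card.1 (by rw [T.2.2]; norm_num : 1 < T.1.card)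
  refine ⟨m a₀ a₀, m a₀ b₀, fun hAB => ?_, fun a ha b hb => ?_⟩
  · have hint : ∀ c d, IntegrableOn (fun x => T.bary c x * T.bary d x) T.carrier := fun c d =>
      T.integrableOn ((T.continuous_bary c).mul (T.continuous_bary d))
    have hsq : ∫ x in T.carrier, (T.bary a₀ x - T.bary b₀ x) ^ 2 = 0 := by
      have : ∀ x, (T.bary a₀ x - T.bary b₀ x) ^ 2 = T.bary a₀ x * T.bary a₀ x -
          2 * (T.bary a₀ x * T.bary b₀ x) + T.bary b₀ x * T.bary b₀ x := fun x => by ring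
      simp only [this]
      have hint' : IntegrableOn (fun x => T.bary a₀ x * T.bary a₀ x -
          2 * (T.bary a₀ x * T.bary b₀ x)) T.carrier := (hint _ _).sub ((hint _ _).const_mul 2)
      rw [integral_add hint' (hint _ _), integral_sub (hint _ _) ((hint _ _).const_mul 2),
        integral_const_mul]
      have h1 := hdiag a₀ ha₀ b₀ hb₀
      simp only [hm] at h1 hAB
      linarith
    have := T.eq_zero_of_setIntegral_eq_zero
      (((T.continuous_bary a₀).sub (T.continuous_bary b₀)).pow 2) (fun x => sq_nonneg _) hsq
      (T.vertex_mem ha₀)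
    simp [T.bary_self ha₀, T.bary_of_ne ha₀ hab₀.symm] at this
  · split_ifs with hab
    · rw [← hab]
      exact hdiag a ha a₀ ha₀
    · change m a b = m a₀ b₀
      by_cases h : a = a₀
      · rw [h]
        exact hrow _ ha₀ _ hb _ hb₀ (by rw [← h]; exact Ne.symm hab) hab₀.symm
      · rw [hrow a ha b hb a₀ ha₀ (Ne.symm hab) (Ne.symm h), hcomm,
          hrow a₀ ha₀ a ha b₀ hb₀ h hab₀.symm]

/-- The barycentric coordinates that belong to a common face have opposite gradients up to the
volumes: both gradients are normal to the face, and of length (area of the face) / (3 · volume). -/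
theorem Tet.vol_mul_grad {T S : G.Tet} (hTS : T ≠ S) {a c : E3} (ha : a ∈ T.1) (hc : c ∈ S.1)
    (hF : T.1.erase a = S.1.erase c) (v : E3) :
    S.vol * S.grad c v = -(T.vol * T.grad a v) := by
  have hneg := Tet.bary_neg hTS ha hc hF
  have hdet : 1 + (T.baryMap a).linear (c - a) = T.bary a c := by
    rw [← T.grad_apply, T.grad_sub, T.bary_self ha]; ring
  have himage : T.1.image (shear (T.baryMap a) (c - a)) = S.1 := by
    rw [← Finset.insert_erase ha, Finset.image_insert, ← Finset.insert_erase hc, ← hF]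
    congr 1
    · rw [shear_apply, T.baryMap_apply, T.bary_self ha]; simp
    · rw [Finset.image_congr (g := id), Finset.image_id]
      intro b hb
      rw [Finset.mem_coe, Finset.mem_erase] at hb
      rw [shear_apply, T.baryMap_apply, T.bary_of_ne hb.2 hb.1.symm]
      simp
  have hvol : S.vol = -T.bary a c * T.vol := by
    have := setIntegral_image_shear (l := T.baryMap a) (v := c - a) (by rw [hdet]; exact hneg.ne)
      T.isCompact_carrier.measurableSet fun _ => 1
    rwa [Tet.image_shear himage, hdet, abs_of_neg hneg] at this
  have hgrad : T.grad a v = T.bary a c * S.grad c v := by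
    have h1 := Tet.bary_eq_mul hc hF (0 + v)
    rw [T.bary_add, S.bary_add, Tet.bary_eq_mul hc hF 0] at h1
    linarith
  rw [hvol, hgrad]
  ring

/-! ### Injectivity of the discrete gradient -/

theorem sum_apply_unitVec (l : E3 →L[ℝ] ℝ) (v : E3) : ∑ i : Fin 3, l (unitVec i) * v i = l v := by
  have hv : v = ∑ i : Fin 3, v i • unitVec i := by
    ext j
    simp [unitVec, Pi.single_apply]
  conv_rhs => rw [hv, map_sum]
  simp only [map_smul, smul_eq_mul, mul_comm]

theorem divergence_smul {φ : E3 → ℝ} {φ' : E3 →L[ℝ] ℝ} {x : E3} (h : HasFDerivAt φ φ' x) (v : E3) :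
    divergence (fun y => φ y • v) x = φ' v := by
  rw [divergence, (h.smul_const v).fderiv, ← sum_apply_unitVec φ' v]
  rfl

theorem divergence_zero (x : E3) : divergence 0 x = 0 := by
  simp [divergence]

theorem Tet.hasFDerivAt_bary_sq (T : G.Tet) (a x : E3) :
    HasFDerivAt (fun y => T.bary a y ^ 2) ((2 * T.bary a x) • T.grad a) x := by
  refine ((T.hasFDerivAt_bary a x).pow 2).congr_fderiv ?_
  simp

theorem Tet.hasFDerivAt_centralBubble (T : G.Tet) (x : E3) : HasFDerivAt T.centralBubble
    (-((4 : ℝ) • ∑ b ∈ T.1, (2 * T.bary b x) • T.grad b)) x :=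
  ((HasFDerivAt.fun_sum fun b _ => T.hasFDerivAt_bary_sq b x).const_mul 4).const_sub 2

theorem Tet.hasFDerivAt_faceBubble (T : G.Tet) (a x : E3) : HasFDerivAt (T.faceBubble a)
    ((12 : ℝ) • ((2 * (1 - T.bary a x)) • -T.grad a)
      - (18 : ℝ) • ∑ b ∈ T.1.erase a, (2 * T.bary b x) • T.grad b
      - ((3 / 2 : ℝ) ^ 3) • -((4 : ℝ) • ∑ b ∈ T.1, (2 * T.bary b x) • T.grad b)) x := by
  have h1 : HasFDerivAt (fun y => (1 - T.bary a y) ^ 2)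
      ((2 * (1 - T.bary a x)) • -T.grad a) x := by
    refine (((T.hasFDerivAt_bary a x).const_sub 1).pow 2).congr_fderiv ?_
    simp
  exact ((h1.const_mul 12).sub
    ((HasFDerivAt.fun_sum fun b _ => T.hasFDerivAt_bary_sq b x).const_mul 18)).sub
    ((T.hasFDerivAt_centralBubble x).const_mul _)

/-- Tested with the central bubble, the divergence form sees exactly the gradient of an affine
pressure. -/
theorem Tet.exists_integral_divergence_centralBubble (T : G.Tet) : ∃ κ : ℝ, κ ≠ 0 ∧
    ∀ (v : E3) (q : E3 →ᵃ[ℝ] ℝ),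
      ∫ x in T.carrier, divergence (fun y => T.centralBubble y • v) x * q x = κ * q.linear v := by
  obtain ⟨A, B, hAB, hmass⟩ := T.exists_mass
  refine ⟨-8 * (A - B), mul_ne_zero (by norm_num) (sub_ne_zero.2 hAB), fun v q => ?_⟩
  have hmoment : ∀ b ∈ T.1, ∫ x in T.carrier, T.bary b x * q x =
      (A - B) * q b + B * ∑ c ∈ T.1, q c := by
    intro b hb
    have : ∀ x, T.bary b x * q x = ∑ c ∈ T.1, q c * (T.bary b x * T.bary c x) := fun x => by
      rw [T.affine_eq_sum q x, Finset.mul_sum]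
      exact Finset.sum_congr rfl fun c _ => by ring
    simp only [this]
    have hi : ∀ c, Integrable (fun x => T.bary b x * T.bary c x) (volume.restrict T.carrier) :=
      fun c => T.integrableOn ((T.continuous_bary b).mul (T.continuous_bary c))
    rw [integral_finsetSum _ fun c _ => (hi c).const_mul _]
    have hterm : ∀ c ∈ T.1, ∫ x in T.carrier, q c * (T.bary b x * T.bary c x) =
        (if b = c then (A - B) * q c else 0) + B * q c := fun c hc => by
      rw [integral_const_mul, hmass b hb c hc]
      split_ifs <;> ring
    rw [Finset.sum_congr rfl hterm, Finset.sum_add_distrib, Finset.sum_ite_eq, if_pos hb,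
      Finset.mul_sum]
  have hdiv : ∀ x, divergence (fun y => T.centralBubble y • v) x * q x =
      ∑ b ∈ T.1, (-8 * T.grad b v) * (T.bary b x * q x) := fun x => by
    rw [divergence_smul (T.hasFDerivAt_centralBubble x)]
    simp only [_root_.neg_apply, _root_.smul_apply,
      _root_.sum_apply, smul_eq_mul, Finset.mul_sum, Finset.sum_mul, neg_mul,
      ← Finset.sum_neg_distrib]
    exact Finset.sum_congr rfl fun b _ => by ring
  simp only [hdiv]
  have hi : ∀ b, Integrable (fun x => T.bary b x * q x) (volume.restrict T.carrier) :=
    fun b => T.integrableOn ((T.continuous_bary b).mul q.continuous_of_finiteDimensional)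
  rw [integral_finsetSum _ fun b _ => (hi b).const_mul _]
  simp only [integral_const_mul]
  rw [Finset.sum_congr rfl fun b hb => by rw [hmoment b hb]]
  have hterm : ∀ b ∈ T.1, (-8 * T.grad b v) * ((A - B) * q b + B * ∑ c ∈ T.1, q c) =
      -8 * (A - B) * (T.grad b v * q b) + T.grad b v * (-8 * (B * ∑ c ∈ T.1, q c)) :=
    fun b _ => by ring
  rw [Finset.sum_congr rfl hterm, Finset.sum_add_distrib, ← Finset.sum_mul, T.sum_grad_apply,
    zero_mul, add_zero, ← Finset.mul_sum, ← T.linear_eq_sum]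

theorem Tet.integral_divergence_faceBubble (T : G.Tet) {a : E3} (ha : a ∈ T.1) (v : E3) :
    ∫ x in T.carrier, divergence (fun y => T.faceBubble a y • v) x = -9 * (T.vol * T.grad a v) := by
  have hdiv : ∀ x, divergence (fun y => T.faceBubble a y • v) x =
      -24 * T.grad a v + 60 * T.grad a v * T.bary a x
        + ∑ b ∈ T.1, (-9 * T.grad b v) * T.bary b x := fun x => by
    rw [divergence_smul (T.hasFDerivAt_faceBubble a x)]
    simp only [_root_.neg_apply, _root_.smul_apply,
      _root_.sum_apply, _root_.sub_apply, smul_eq_mul]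
    have h1 : ∑ b ∈ T.1.erase a, 2 * T.bary b x * T.grad b v =
        ∑ b ∈ T.1, 2 * T.bary b x * T.grad b v - 2 * T.bary a x * T.grad a v := by
      rw [T.sum_eq_add_erase ha]; ring
    have h2 : ∑ b ∈ T.1, (-9 * T.grad b v) * T.bary b x =
        -9 / 2 * ∑ b ∈ T.1, 2 * T.bary b x * T.grad b v := by
      rw [Finset.mul_sum]
      exact Finset.sum_congr rfl fun b _ => by ring
    rw [h1, h2]
    ring
  have hc : ∀ b, Integrable (T.bary b) (volume.restrict T.carrier) := fun b =>
    T.integrableOn (T.continuous_bary b)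
  have hconst : ∫ _ in T.carrier, (-24 * T.grad a v : ℝ) = -24 * T.grad a v * T.vol := by
    rw [Tet.vol, ← integral_const_mul]; simp
  have hsum : ∫ x in T.carrier, ∑ b ∈ T.1, (-9 * T.grad b v) * T.bary b x = 0 := by
    rw [integral_finsetSum _ fun b _ => (hc b).const_mul _]
    have : ∀ b ∈ T.1, ∫ x in T.carrier, (-9 * T.grad b v) * T.bary b x =
        T.grad b v * (-9 * (T.vol / 4)) := fun b hb => by
      rw [integral_const_mul, T.setIntegral_bary hb]; ring
    rw [Finset.sum_congr rfl this, ← Finset.sum_mul, T.sum_grad_apply, zero_mul]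
  have hi1 : Integrable (fun _ => (-24 * T.grad a v : ℝ)) (volume.restrict T.carrier) :=
    T.integrableOn continuous_const
  have hi2 : Integrable (fun x => -24 * T.grad a v + 60 * T.grad a v * T.bary a x)
      (volume.restrict T.carrier) := hi1.add ((hc a).const_mul _)
  simp only [hdiv]
  rw [integral_add hi2 (integrable_finsetSum _ fun b _ => (hc b).const_mul _), hsum,
    integral_add hi1 ((hc a).const_mul _), hconst, integral_const_mul, T.setIntegral_bary ha]
  ring

/-- A unit normal of a face is not orthogonal to the gradient of the opposite coordinate. -/
theorem Tet.grad_normal_ne_zero (T : G.Tet) {a : E3} (ha : a ∈ T.1) {v : E3} (hv : ‖v‖ = 1)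
    (horth : ∀ x ∈ T.1.erase a, ∀ y ∈ T.1.erase a, inner ℝ v (x - y) = 0) : T.grad a v ≠ 0 := by
  intro h0
  obtain ⟨b₀, hb₀⟩ : (T.1.erase a).Nonempty :=
    Finset.card_pos.1 (by rw [T.card_erase ha]; norm_num)
  have h1 := T.sum_grad_smul v
  have h2 := T.sum_grad_apply v
  rw [T.sum_eq_add_erase ha, h0, zero_smul, zero_add] at h1
  rw [T.sum_eq_add_erase ha, h0, zero_add] at h2
  have h3 : ∑ b ∈ T.1.erase a, T.grad b v • (b - b₀) = v := by
    simp only [smul_sub, Finset.sum_sub_distrib, ← Finset.sum_smul, h1, h2, zero_smul, sub_zero]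
  have h4 : inner ℝ v v = 0 := by
    conv_lhs => rw [← h3, inner_sum, h3]
    refine Finset.sum_eq_zero fun b hb => ?_
    rw [inner_smul_right, horth b hb b₀ hb₀, mul_zero]
  rw [inner_self_eq_zero.1 h4, norm_zero] at hv
  exact zero_ne_one hv

theorem faceBasis_apply {T : G.Tet} {a : E3} (ha : a ∈ T.1) (v : E3) :
    G.faceBasis (T.1.erase a) v T = fun x => T.faceBubble a x • v := by
  ext x : 1
  rw [faceBasis, Finset.sum_eq_single a]
  · intro b hb hba
    rw [Finset.mem_filter] at hb
    exact absurd (Finset.erase_injOn T.1 hb.1 ha hb.2) hba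
  · exact fun h => absurd ha fun ha => h (Finset.mem_filter.2 ⟨ha, rfl⟩)

/-- A triangle is a face of at most two tetrahedra. -/
theorem eq_or_eq_of_shared {T S R : G.Tet} (hTS : T ≠ S) {a c d : E3} (ha : a ∈ T.1) (hc : c ∈ S.1)
    (hd : d ∈ R.1) (hF : T.1.erase a = S.1.erase c) (hR : T.1.erase a = R.1.erase d) :
    R = T ∨ R = S := by
  by_contra! h
  have h1 := Tet.bary_neg hTS ha hc hF
  have h2 := Tet.bary_neg h.1.symm ha hd hR
  have h3 := Tet.bary_neg h.2.symm hc hd (hF.symm.trans hR)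
  rw [Tet.bary_eq_mul hc hF] at h2
  exact absurd h2 (mul_pos_of_neg_of_neg h1 h3).le.not_gt

/-- Tested with the bubble of an interior face, the divergence form sees the jump of a piecewise
constant pressure. -/
theorem eq_of_divForm_faceBasis {T S : G.Tet} (hTS : T ≠ S) {a c : E3} (ha : a ∈ T.1)
    (hc : c ∈ S.1) (hF : T.1.erase a = S.1.erase c) {v : E3} (hv : ‖v‖ = 1)
    (horth : ∀ x ∈ T.1.erase a, ∀ y ∈ T.1.erase a, inner ℝ v (x - y) = 0) {q : G.BrokenScalar}
    (hq : ∀ R x, q R x = q R 0) (h : G.divForm (G.faceBasis (T.1.erase a) v) q = 0) :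
    q T 0 = q S 0 := by
  have hterm : ∀ (R : G.Tet) (d : E3), d ∈ R.1 → T.1.erase a = R.1.erase d →
      ∫ x in R.carrier, divergence (G.faceBasis (T.1.erase a) v R) x * q R x =
        -9 * (R.vol * R.grad d v) * q R 0 := by
    intro R d hd hR
    rw [hR, faceBasis_apply hd]
    simp only [hq R]
    rw [integral_mul_const, R.integral_divergence_faceBubble hd]
  have hzero : ∀ R : G.Tet, R ≠ T → R ≠ S →
      ∫ x in R.carrier, divergence (G.faceBasis (T.1.erase a) v R) x * q R x = 0 := by
    intro R hRT hRS
    have : G.faceBasis (T.1.erase a) v R = 0 := by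
      ext x : 1
      refine Finset.sum_eq_zero fun d hd => ?_
      rw [Finset.mem_filter] at hd
      rcases eq_or_eq_of_shared hTS ha hc hd.1 hF hd.2.symm with h | h
      · exact absurd h hRT
      · exact absurd h hRS
    simp [this, divergence_zero]
  rw [divForm, ← Finset.sum_subset (Finset.subset_univ {T, S}) fun R _ hR => hzero R
    (fun h => hR (by simp [h])) (fun h => hR (by simp [h])), Finset.sum_pair hTS,
    hterm T a ha rfl, hterm S c hc hF, Tet.vol_mul_grad hTS ha hc hF] at h
  have h' : (T.vol * T.grad a v) * (q T 0 - q S 0) = 0 := by linarith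
  rcases mul_eq_zero.1 h' with h' | h'
  · exact absurd h' (mul_ne_zero T.vol_pos.ne' (T.grad_normal_ne_zero ha hv horth))
  · linarith

theorem cellBasis_mem_velocitySpace (n : Finset E3 → E3) (S : G.Tet) (m : Fin 3) :
    G.cellBasis S m ∈ G.velocitySpace n :=
  Submodule.subset_span (Or.inl (Or.inl (Or.inl ⟨S, m, rfl⟩)))

theorem faceBasis_mem_velocitySpace (n : Finset E3 → E3) {F : Finset E3}
    (hF : F ∈ G.interiorTriangles) : G.faceBasis F (n F) ∈ G.velocitySpace n :=
  Submodule.subset_span (Or.inl (Or.inl (Or.inr ⟨F, hF, rfl⟩)))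

theorem divForm_cellBasis (S : G.Tet) (m : Fin 3) (q : G.BrokenScalar) :
    G.divForm (G.cellBasis S m) q =
      ∫ x in S.carrier, divergence (fun y => S.centralBubble y • unitVec m) x * q S x := by
  rw [divForm, Finset.sum_eq_single S]
  · have : G.cellBasis S m S = fun y => S.centralBubble y • unitVec m := by
      ext x : 1
      simp [cellBasis]
    rw [this]
  · intro T _ hTS
    have : G.cellBasis S m T = 0 := by
      ext x : 1
      simp [cellBasis, hTS]
    simp [this, divergence_zero]
  · exact fun h => absurd (Finset.mem_univ S) h

theorem erase_mem_interiorTriangles {T S : G.Tet} (hTS : T ≠ S) {a c : E3} (ha : a ∈ T.1)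
    (hc : c ∈ S.1) (hF : T.1.erase a = S.1.erase c) : T.1.erase a ∈ G.interiorTriangles := by
  have hne : (T.1.erase a).Nonempty := Finset.card_pos.1 (by rw [T.card_erase ha]; norm_num)
  refine ⟨G.toSimplicialComplex.down_closed T.2.1 (Finset.erase_subset _ _) hne, T.card_erase ha,
    Tet.mem_domain_of_shared_face hTS ha hc hF ?_ fun b hb => ?_⟩
  · rw [T.bary_centroid (Finset.erase_subset _ _) hne, if_neg (Finset.notMem_erase _ _)]
  · rw [T.bary_centroid (Finset.erase_subset _ _) hne, if_pos hb, T.card_erase ha]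
    norm_num

/-- The discrete inf-sup property: a pressure that is orthogonal to the divergence of all discrete
velocities vanishes. -/
theorem eq_zero_of_divForm_eq_zero (hconn : IsConnected G.domain) {n : Finset E3 → E3}
    (hn : G.IsUnitNormalField n) {q : G.BrokenScalar} (hq : q ∈ G.pressureSpace)
    (h : ∀ v ∈ G.velocitySpace n, G.divForm v q = 0) : q = 0 := by
  obtain ⟨haff, hmean⟩ := hq
  have hconst : ∀ T x, q T x = q T 0 := by
    intro T x
    obtain ⟨p, hp⟩ := haff T
    obtain ⟨κ, hκ, hint⟩ := T.exists_integral_divergence_centralBubble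
    have hlin : ∀ m, p.linear (unitVec m) = 0 := fun m => by
      have h0 := h _ (cellBasis_mem_velocitySpace n T m)
      rw [divForm_cellBasis, hp, hint] at h0
      exact (mul_eq_zero.1 h0).resolve_left hκ
    have := p.map_vadd 0 x
    rw [vadd_eq_add, add_zero, vadd_eq_add] at this
    have h0 := sum_apply_unitVec (LinearMap.toContinuousLinearMap p.linear) x
    simp only [LinearMap.coe_toContinuousLinearMap', hlin, zero_mul, Finset.sum_const_zero] at h0
    rw [hp, this, ← h0, zero_add]
  have hadj : ∀ T S : G.Tet, Adjacent T S → q T 0 = q S 0 := by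
    rintro T S ⟨hTS, a, ha, c, hc, hF⟩
    have hint := erase_mem_interiorTriangles hTS ha hc hF
    exact eq_of_divForm_faceBasis hTS ha hc hF (hn _ hint).1 (hn _ hint).2 hconst
      (h _ (faceBasis_mem_velocitySpace n hint))
  ext T x
  rw [hconst T x]
  have hall : ∀ S : G.Tet, q S 0 = q T 0 :=
    forall_of_adjacent hconn (p := fun S => q S 0 = q T 0)
      (fun R S hRS hR => (hadj R S hRS).symm.trans hR) rfl
  have hsum : q T 0 * ∑ S : G.Tet, S.vol = 0 := by
    rw [← hmean, Finset.mul_sum]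
    refine Finset.sum_congr rfl fun S _ => ?_
    rw [Tet.vol, ← integral_const_mul]
    congr 1
    ext y
    rw [hconst S y, hall S, mul_one]
  refine (mul_eq_zero.1 hsum).resolve_right ?_
  exact (Finset.sum_pos (fun S _ => S.vol_pos) ⟨T, Finset.mem_univ T⟩).ne'

/-! ### The discrete forms -/

theorem continuous_divergence {w : E3 → E3} (hw : w ∈ quadraticMaps E3) :
    Continuous (divergence w) := by
  have := continuous_fderiv_of_mem_quadraticMaps hw
  unfold divergence
  fun_prop

theorem divergence_add {v w : E3 → E3} (hv : v ∈ quadraticMaps E3) (hw : w ∈ quadraticMaps E3)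
    (x : E3) : divergence (v + w) x = divergence v x + divergence w x := by
  unfold divergence
  rw [fderiv_add (differentiable_of_mem_quadraticMaps hv x)
    (differentiable_of_mem_quadraticMaps hw x), ← Finset.sum_add_distrib]
  rfl

theorem divergence_const_smul {w : E3 → E3} (hw : w ∈ quadraticMaps E3) (c : ℝ) (x : E3) :
    divergence (c • w) x = c * divergence w x := by
  unfold divergence
  rw [fderiv_const_smul (differentiable_of_mem_quadraticMaps hw x), Finset.mul_sum]
  rfl

/-- The integrand of the form `gradForm`. -/
noncomputable def gradInner (v w : E3 → E3) (x : E3) : ℝ :=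
  ∑ i : Fin 3, ∑ j : Fin 3, (fderiv ℝ v x (unitVec i)) j * (fderiv ℝ w x (unitVec i)) j

theorem gradForm_eq (u v : G.BrokenField) :
    G.gradForm u v = ∑ T, ∫ x in T.carrier, gradInner (u T) (v T) x := rfl

theorem continuous_gradInner {v w : E3 → E3} (hv : v ∈ quadraticMaps E3)
    (hw : w ∈ quadraticMaps E3) : Continuous (gradInner v w) := by
  have h1 := continuous_fderiv_of_mem_quadraticMaps hv
  have h2 := continuous_fderiv_of_mem_quadraticMaps hw
  unfold gradInner
  fun_prop

theorem gradInner_comm (v w : E3 → E3) : gradInner v w = gradInner w v := by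
  ext x
  simp only [gradInner, mul_comm]

theorem gradInner_add {v w : E3 → E3} (u : E3 → E3) (hv : v ∈ quadraticMaps E3)
    (hw : w ∈ quadraticMaps E3) (x : E3) :
    gradInner u (v + w) x = gradInner u v x + gradInner u w x := by
  unfold gradInner
  rw [fderiv_add (differentiable_of_mem_quadraticMaps hv x)
    (differentiable_of_mem_quadraticMaps hw x)]
  simp only [← Finset.sum_add_distrib, ← mul_add]
  rfl

theorem gradInner_const_smul {w : E3 → E3} (u : E3 → E3) (hw : w ∈ quadraticMaps E3) (c : ℝ)
    (x : E3) : gradInner u (c • w) x = c * gradInner u w x := by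
  unfold gradInner
  rw [fderiv_const_smul (differentiable_of_mem_quadraticMaps hw x)]
  simp only [Finset.mul_sum, mul_left_comm c]
  rfl

variable {n : Finset E3 → E3}

theorem gradForm_comm (u v : G.BrokenField) : G.gradForm u v = G.gradForm v u := by
  simp only [gradForm_eq, gradInner_comm]

theorem gradForm_add {u v w : G.BrokenField} (hu : u ∈ G.velocitySpace n)
    (hv : v ∈ G.velocitySpace n) (hw : w ∈ G.velocitySpace n) :
    G.gradForm u (v + w) = G.gradForm u v + G.gradForm u w := by
  simp only [gradForm_eq, ← Finset.sum_add_distrib]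
  refine Finset.sum_congr rfl fun T _ => ?_
  have hu' := quadratic_of_mem_velocitySpace hu T
  have hv' := quadratic_of_mem_velocitySpace hv T
  have hw' := quadratic_of_mem_velocitySpace hw T
  rw [← integral_add (T.integrableOn (continuous_gradInner hu' hv'))
    (T.integrableOn (continuous_gradInner hu' hw'))]
  congr 1
  ext x
  exact gradInner_add _ hv' hw' x

theorem gradForm_smul (u : G.BrokenField) {v : G.BrokenField} (hv : v ∈ G.velocitySpace n)
    (c : ℝ) : G.gradForm u (c • v) = c * G.gradForm u v := by
  simp only [gradForm_eq, Finset.mul_sum, ← integral_const_mul]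
  refine Finset.sum_congr rfl fun T _ => ?_
  congr 1
  ext x
  exact gradInner_const_smul _ (quadratic_of_mem_velocitySpace hv T) c x

theorem continuous_of_mem_pressureSpace {q : G.BrokenScalar} (hq : q ∈ G.pressureSpace)
    (T : G.Tet) : Continuous (q T) := by
  obtain ⟨a, ha⟩ := hq.1 T
  rw [ha]
  exact a.continuous_of_finiteDimensional

theorem integrableOn_divForm {v : G.BrokenField} {q : G.BrokenScalar}
    (hv : v ∈ G.velocitySpace n) (hq : q ∈ G.pressureSpace) (T : G.Tet) :
    IntegrableOn (fun x => divergence (v T) x * q T x) T.carrier :=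
  T.integrableOn ((continuous_divergence (quadratic_of_mem_velocitySpace hv T)).mul
    (continuous_of_mem_pressureSpace hq T))

theorem divForm_add_left {v w : G.BrokenField} {q : G.BrokenScalar} (hv : v ∈ G.velocitySpace n)
    (hw : w ∈ G.velocitySpace n) (hq : q ∈ G.pressureSpace) :
    G.divForm (v + w) q = G.divForm v q + G.divForm w q := by
  simp only [divForm, ← Finset.sum_add_distrib]
  refine Finset.sum_congr rfl fun T _ => ?_
  rw [← integral_add (integrableOn_divForm hv hq T) (integrableOn_divForm hw hq T)]
  congr 1
  ext x
  rw [Pi.add_apply, divergence_add (quadratic_of_mem_velocitySpace hv T)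
    (quadratic_of_mem_velocitySpace hw T), add_mul]

theorem divForm_smul_left {v : G.BrokenField} (hv : v ∈ G.velocitySpace n) (q : G.BrokenScalar)
    (c : ℝ) : G.divForm (c • v) q = c * G.divForm v q := by
  simp only [divForm, Finset.mul_sum, ← integral_const_mul]
  refine Finset.sum_congr rfl fun T _ => ?_
  congr 1
  ext x
  rw [Pi.smul_apply, divergence_const_smul (quadratic_of_mem_velocitySpace hv T), mul_assoc]

theorem divForm_add_right {v : G.BrokenField} {p q : G.BrokenScalar} (hv : v ∈ G.velocitySpace n)
    (hp : p ∈ G.pressureSpace) (hq : q ∈ G.pressureSpace) :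
    G.divForm v (p + q) = G.divForm v p + G.divForm v q := by
  simp only [divForm, ← Finset.sum_add_distrib]
  refine Finset.sum_congr rfl fun T _ => ?_
  rw [← integral_add (integrableOn_divForm hv hp T) (integrableOn_divForm hv hq T)]
  congr 1
  ext x
  simp only [Pi.add_apply, mul_add]

theorem divForm_smul_right (v : G.BrokenField) (q : G.BrokenScalar) (c : ℝ) :
    G.divForm v (c • q) = c * G.divForm v q := by
  simp only [divForm, Finset.mul_sum, ← integral_const_mul]
  refine Finset.sum_congr rfl fun T _ => ?_
  congr 1
  ext x
  simp only [Pi.smul_apply, smul_eq_mul]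
  ring

theorem integrableOn_loadForm {f : E3 → E3} (hf : MemLp f 2 (volume.restrict G.domain))
    {v : G.BrokenField} (hv : v ∈ G.velocitySpace n) (T : G.Tet) :
    IntegrableOn (fun x => inner ℝ (f x) (v T x) : E3 → ℝ) T.carrier := by
  have hcont := continuous_of_mem_quadraticMaps (quadratic_of_mem_velocitySpace hv T)
  have hfin : IsFiniteMeasure (volume.restrict (interior T.carrier)) :=
    ⟨by
      rw [Measure.restrict_apply_univ]
      exact (measure_mono interior_subset).trans_lt T.isCompact_carrier.measure_lt_top⟩
  have hfT : IntegrableOn f (interior T.carrier) :=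
    (hf.mono_measure (Measure.restrict_mono (interior_mono T.carrier_subset_space)
      le_rfl)).integrable (by norm_num)
  -- The boundary of a tetrahedron is a null set.
  have hae : interior T.carrier =ᵐ[volume] T.carrier := by
    refine interior_ae_eq_of_null_frontier (T.convex_carrier.addHaar_frontier volume)
  have hfT' : IntegrableOn f T.carrier := hfT.congr_set_ae hae.symm
  obtain ⟨C, hC⟩ := T.isCompact_carrier.exists_bound_of_continuousOn hcont.continuousOn
  refine (hfT'.norm.mul_const C).mono' ?_ ?_
  · exact hfT'.aestronglyMeasurable.inner hcont.aestronglyMeasurable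
  · refine (ae_restrict_iff' T.isCompact_carrier.measurableSet).2
      (Filter.Eventually.of_forall fun x hx => ?_)
    exact (norm_inner_le_norm _ _).trans (mul_le_mul_of_nonneg_left (hC x hx) (norm_nonneg _))

theorem loadForm_add {f : E3 → E3} (hf : MemLp f 2 (volume.restrict G.domain))
    {v w : G.BrokenField} (hv : v ∈ G.velocitySpace n) (hw : w ∈ G.velocitySpace n) :
    G.loadForm f (v + w) = G.loadForm f v + G.loadForm f w := by
  simp only [loadForm, ← Finset.sum_add_distrib]
  refine Finset.sum_congr rfl fun T _ => ?_
  rw [← integral_add (integrableOn_loadForm hf hv T) (integrableOn_loadForm hf hw T)]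
  congr 1
  ext x
  exact inner_add_right _ _ _

theorem loadForm_smul (f : E3 → E3) (v : G.BrokenField) (c : ℝ) :
    G.loadForm f (c • v) = c * G.loadForm f v := by
  simp only [loadForm, Finset.mul_sum, ← integral_const_mul]
  refine Finset.sum_congr rfl fun T _ => ?_
  congr 1
  ext x
  exact inner_smul_right _ _ _

/-- The broken gradient form is definite on the velocity space. -/
theorem eq_zero_of_gradForm_self_eq_zero {u : G.BrokenField} (hu : u ∈ G.velocitySpace n)
    (h : G.gradForm u u = 0) : u = 0 := by
  refine eq_zero_of_piecewise_constant hu fun T x y => ?_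
  have hnn : ∀ (S : G.Tet) x, 0 ≤ gradInner (u S) (u S) x := fun S x =>
    Finset.sum_nonneg fun i _ => Finset.sum_nonneg fun j _ => mul_self_nonneg _
  have hq := quadratic_of_mem_velocitySpace hu T
  have hT : ∫ x in T.carrier, gradInner (u T) (u T) x = 0 :=
    (Finset.sum_eq_zero_iff_of_nonneg fun S _ => integral_nonneg (hnn S)).1 h T (Finset.mem_univ T)
  refine eq_of_fderiv_eq_zero hq isOpen_interior T.interior_nonempty (fun z hz => ?_) x y
  have hz0 := T.eq_zero_of_setIntegral_eq_zero (continuous_gradInner hq hq) (hnn T) hT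
    (interior_subset hz)
  have hentry : ∀ i j, (fderiv ℝ (u T) z (unitVec i)) j = 0 := fun i j => by
    have h1 := (Finset.sum_eq_zero_iff_of_nonneg fun i _ =>
      Finset.sum_nonneg fun j _ => mul_self_nonneg _).1 hz0 i (Finset.mem_univ i)
    have h2 := (Finset.sum_eq_zero_iff_of_nonneg fun j _ => mul_self_nonneg _).1 h1 j
      (Finset.mem_univ j)
    exact mul_self_eq_zero.1 h2
  ext v j
  have hsum := sum_apply_unitVec ((EuclideanSpace.proj j).comp (fderiv ℝ (u T) z)) v
  exact hsum.symm.trans (Finset.sum_eq_zero fun i _ => mul_eq_zero_of_left (hentry i j) _)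

/-! ### Unique solvability -/

instance finiteDimensional_velocitySpace (G : TetGrid) (n : Finset E3 → E3) :
    FiniteDimensional ℝ (G.velocitySpace n) := by
  have hvert : G.interiorVertices.Finite :=
    (G.finite_faces.preimage (Finset.singleton_injective.injOn)).subset fun a ha => ha.1
  refine FiniteDimensional.span_of_finite ℝ ?_
  refine ((Set.Finite.union ?_ ?_).union ?_).union ?_
  · exact (Set.finite_range fun p : G.Tet × Fin 3 => G.cellBasis p.1 p.2).subset
      (by rintro _ ⟨S, m, rfl⟩; exact ⟨(S, m), rfl⟩)
  · exact ((G.finite_faces.subset fun F hF => hF.1 : G.interiorTriangles.Finite).image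
      fun F => G.faceBasis F (n F)).subset (by rintro _ ⟨F, hF, rfl⟩; exact ⟨F, hF, rfl⟩)
  · exact ((hvert.prod (Set.finite_univ : (Set.univ : Set (Fin 3)).Finite)).image
      fun p => G.vertexBasis p.1 p.2).subset
        (by rintro _ ⟨a, ha, m, rfl⟩; exact ⟨(a, m), ⟨ha, Set.mem_univ m⟩, rfl⟩)
  · exact (((G.finite_faces.subset fun e he => he.1 : G.interiorEdges.Finite).prod
      (Set.finite_univ : (Set.univ : Set (Fin 3)).Finite)).image
      fun p => G.edgeBasis p.1 p.2).subset
        (by rintro _ ⟨e, he, m, rfl⟩; exact ⟨(e, m), ⟨he, Set.mem_univ m⟩, rfl⟩)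

instance finiteDimensional_pressureSpace (G : TetGrid) : FiniteDimensional ℝ G.pressureSpace := by
  let ev : G.pressureSpace →ₗ[ℝ] ((T : G.Tet) → T.1 → ℝ) :=
    { toFun := fun q T a => (q : G.BrokenScalar) T a
      map_add' := fun _ _ => rfl
      map_smul' := fun _ _ => rfl }
  refine FiniteDimensional.of_injective ev ((injective_iff_map_eq_zero ev).2 fun q hq => ?_)
  ext T x
  obtain ⟨a, ha⟩ := q.2.1 T
  rw [ha, T.affine_eq_sum]
  refine Finset.sum_eq_zero fun b hb => ?_
  have : (q : G.BrokenScalar) T b = 0 := congrFun (congrFun hq T) ⟨b, hb⟩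
  rw [ha] at this
  rw [this, mul_zero]

theorem bijective_of_injective_dual {V P : Type*} [AddCommGroup V] [Module ℝ V]
    [FiniteDimensional ℝ V] [AddCommGroup P] [Module ℝ P] [FiniteDimensional ℝ P]
    {L : V × P →ₗ[ℝ] Module.Dual ℝ V × Module.Dual ℝ P} (h : Function.Injective L) :
    Function.Bijective L :=
  ⟨h, (LinearMap.injective_iff_surjective_of_finrank_eq_finrank
    (by rw [Module.finrank_prod, Module.finrank_prod, Subspace.dual_finrank_eq,
      Subspace.dual_finrank_eq])).1 h⟩

/-- The linear operator of the discrete Stokes equations. -/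
noncomputable def stokesOperator (G : TetGrid) (n : Finset E3 → E3) :
    G.velocitySpace n × G.pressureSpace →ₗ[ℝ]
      Module.Dual ℝ (G.velocitySpace n) × Module.Dual ℝ G.pressureSpace where
  toFun up :=
    ({ toFun := fun v => G.gradForm up.1 v - G.divForm v up.2
       map_add' := fun v w => by
        rw [Submodule.coe_add, gradForm_add up.1.2 v.2 w.2, divForm_add_left v.2 w.2 up.2.2]
        ring
       map_smul' := fun c v => by
        rw [Submodule.coe_smul, gradForm_smul _ v.2, divForm_smul_left v.2]
        simp only [RingHom.id_apply, smul_eq_mul]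
        ring },
     { toFun := fun q => G.divForm up.1 q
       map_add' := fun p q => divForm_add_right up.1.2 p.2 q.2
       map_smul' := fun c q => divForm_smul_right _ _ c })
  map_add' up vq := by
    refine Prod.ext (LinearMap.ext fun w => ?_) (LinearMap.ext fun r => ?_)
    · change G.gradForm (up.1 + vq.1 : G.BrokenField) w - G.divForm w (up.2 + vq.2 : G.BrokenScalar)
        = (G.gradForm up.1 w - G.divForm w up.2) + (G.gradForm vq.1 w - G.divForm w vq.2)
      rw [gradForm_comm, gradForm_add w.2 up.1.2 vq.1.2, divForm_add_right w.2 up.2.2 vq.2.2,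
        gradForm_comm _ (up.1 : G.BrokenField), gradForm_comm _ (vq.1 : G.BrokenField)]
      ring
    · exact divForm_add_left up.1.2 vq.1.2 r.2
  map_smul' c up := by
    refine Prod.ext (LinearMap.ext fun w => ?_) (LinearMap.ext fun r => ?_)
    · change G.gradForm (c • up.1 : G.BrokenField) w - G.divForm w (c • up.2 : G.BrokenScalar)
        = c * (G.gradForm up.1 w - G.divForm w up.2)
      rw [gradForm_comm, gradForm_smul _ up.1.2, divForm_smul_right,
        gradForm_comm _ (up.1 : G.BrokenField)]
      ring
    · exact divForm_smul_left up.1.2 _ c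

theorem stokesOperator_injective (hconn : IsConnected G.domain) (hn : G.IsUnitNormalField n) :
    Function.Injective (G.stokesOperator n) := by
  refine (injective_iff_map_eq_zero _).2 fun up hup => ?_
  have h1 : ∀ v : G.velocitySpace n, G.gradForm up.1 v - G.divForm v up.2 = 0 := fun v =>
    LinearMap.congr_fun (congrArg Prod.fst hup) v
  have h2 : ∀ q : G.pressureSpace, G.divForm up.1 q = 0 := fun q =>
    LinearMap.congr_fun (congrArg Prod.snd hup) q
  have hgrad : G.gradForm up.1 up.1 = 0 := by
    have := h1 up.1
    rwa [h2 up.2, sub_zero] at this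
  have hu : up.1 = 0 := Subtype.ext (eq_zero_of_gradForm_self_eq_zero up.1.2 hgrad)
  have hp : (up.2 : G.BrokenScalar) = 0 := eq_zero_of_divForm_eq_zero hconn hn up.2.2 fun v hv => by
    have := h1 ⟨v, hv⟩
    rw [hu, gradForm_comm, ZeroMemClass.coe_zero, ← zero_smul ℝ (0 : G.BrokenField),
      gradForm_smul (n := n) _ (zero_mem _)] at this
    linarith
  exact Prod.ext hu (Subtype.ext hp)

/-- The load as a linear form on the velocity space. -/
noncomputable def loadFunctional (n : Finset E3 → E3) {f : E3 → E3}
    (hf : MemLp f 2 (volume.restrict G.domain)) : Module.Dual ℝ (G.velocitySpace n) where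
  toFun v := G.loadForm f v
  map_add' v w := loadForm_add hf v.2 w.2
  map_smul' c v := by
    rw [Submodule.coe_smul, loadForm_smul, RingHom.id_apply, smul_eq_mul]

theorem stokesOperator_eq_iff {f : E3 → E3} (hf : MemLp f 2 (volume.restrict G.domain))
    (up : G.velocitySpace n × G.pressureSpace) :
    G.stokesOperator n up = (loadFunctional n hf, 0) ↔
      G.IsDiscreteStokesSolution n f (up.1 : G.BrokenField) (up.2 : G.BrokenScalar) := by
  rw [Prod.ext_iff, LinearMap.ext_iff, LinearMap.ext_iff]
  exact ⟨fun h => ⟨fun v hv => h.1 ⟨v, hv⟩, fun q hq => h.2 ⟨q, hq⟩⟩,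
    fun h => ⟨fun v => h.1 v v.2, fun q => h.2 q q.2⟩⟩

end TetGrid

theorem mainTheorem5 (G : TetGrid) (hconn : IsConnected G.domain)
    (n : Finset E3 → E3) (hn : G.IsUnitNormalField n)
    (f : E3 → E3) (hf : MemLp f 2 (volume.restrict G.domain)) :
    ∃! up : G.velocitySpace n × G.pressureSpace,
      G.IsDiscreteStokesSolution n f (up.1 : G.BrokenField) (up.2 : G.BrokenScalar) := by
  have hbij : Function.Bijective (G.stokesOperator n) :=
    TetGrid.bijective_of_injective_dual (TetGrid.stokesOperator_injective hconn hn)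
  simp only [← TetGrid.stokesOperator_eq_iff hf]
  exact hbij.existsUnique _
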